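/- **Setting.** Let $M=(\mathcal S,\mathcal A,r,p)$ be a finite MDP with rewards $r(s,a)\in[0,1]$ that is ergodic: every stationary randomized policy $\pi$ induces an irreducible and aperiodic Markov chain. Let $P^\pi(s,s')=\sum_a\pi(a|s)p(s'|s,a)$ and $r^\pi(s)=\sum_a\pi(a|s)r(s,a)$, let $\mu^\pi$ be the stationary distribution of $P^\pi$, and let $J^\pi=\liminf_{n}\frac1n\mathbb E[\sum_{t\le n}r(s_t,a_t)]$ be the average reward (independent of the initial state). Let $v^\pi$ be the unique solution of $v(s)=r^\pi(s)-J^\pi+\sum_{s'}P^\pi(s,s')v(s')$ with $\sum_s\mu^\pi(s)v(s)=0$, and put $q^\pi(s,a)=r(s,a)+\sum_{s'}p(s'|s,a)v^\pi(s')$. (This is the solution $q$ of the Bellman equation $J^\pi+q(s,a)=r(s,a)+\sum_{s',a'}p(s'|s,a)\pi(a'|s')q(s',a')$, which is unique up to an additive constant, with $\sum_{s,a}\mu^\pi(s)\pi(a|s)q(s,a)=J^\pi$.) Let $$t_{\rm mix}=\max_\pi\min\{t\ge1:\ \|(P^\pi)^t(s,\cdot)-\mu^\pi\|_1\le\tfrac14\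 \forall s\},\qquad t_{\rm hit}=\max_{\pi,s}\frac1{\mu^\pi(s)}.$$ **Algorithm (MDP-OOMD with step size $\eta>0$ and horizon $T\ge2$).** Let $N$ and $B$ be the numbers $4t_{\rm mix}\log_2T$ and $16\,t_{\rm mix}t_{\rm hit}(\log_2T)^2$, each rounded up or down to an integer. The agent starts in an arbitrary state. Let $\pi_1(\cdot|s)=\pi_1'(\cdot|s)$ be uniform. In episode $k=1,2,\dots$, consisting of the steps $(k-1)B+1,\dots,kB$, it draws $a_t\sim\pi_k(\cdot|s_t)$, and $s_{t+1}\sim p(\cdot|s_t,a_t)$. After the episode it computes, for every $s$, the vector $\widehat\beta_k(s,\cdot)$ by ESTIMATE-Q: start at $\tau=(k-1)B+1$; while $\tau\le kB-N$, if $s_\tau=s$, record the vector $y(a)=\frac{\mathbf 1[a_\tau=a]}{\pi_k(a|s)}\sum_{t=\tau}^{\tau+N}r(s_t,a_t)$ and increase $\tau$ by $2N$, otherwise increase $\tau$ by $1$; $\widehat\beta_k(s,\cdot)$ is the average of the recorded vectors, or $0$ if there is none. It then sets, for every $s$, $$\pi'_{k+1}(\cdot|s)=\operatorname*{argmax}_{u\in\Delta_{\mathcal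 A}}\{\langle u,\widehat\beta_k(s,\cdot)\rangle-D_\psi(u,\pi'_k(\cdot|s))\},\qquad \pi_{k+1}(\cdot|s)=\operatorname*{argmax}_{u\in\Delta_{\mathcal A}}\{\langle u,\widehat\beta_k(s,\cdot)\rangle-D_\psi(u,\pi'_{k+1}(\cdot|s))\},$$ where $D_\psi$ is the Bregman divergence of $\psi(u)=\frac1\eta\sum_a\log\frac1{u(a)}$. **Lemma.** Put $\beta^\pi(s,a)=q^\pi(s,a)+NJ^\pi$, and let $\mathbb E_k$ be the expectation conditional on the history before episode $k$ (all earlier states and actions, and the state in which the episode starts). There is a universal constant $C>0$ such that for every such MDP, every $\eta>0$, every $T\ge 2$, every episode $k$ with $kB\le T$, every $s\in\mathcal S$ and every $a\in\mathcal A$, for every history of positive probability, $$\bigl|\mathbb E_k[\widehat\beta_k(s,a)]-\beta^{\pi_k}(s,a)\bigr|\le\frac CT,\qquad \mathbb E_k\bigl[(\widehat\beta_k(s,a)-\beta^{\pi_k}(s,a))^2\bigr]\le C\,\frac{N^3\log T}{B\,\pi_k(a|s)\,\mu^{\pi_k}(s)}.$$ -/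

import Mathlib

open MeasureTheory Filter

noncomputable section

/-- A finite Markov decision process with known rewards in `[0, 1]`: `r s a` is the reward and
`p s a s'` is the probability of moving to `s'` from `s` under the action `a`. -/
structure MDP (S A : Type*) [Fintype S] where
  r : S → A → ℝ
  r_nonneg : ∀ s a, 0 ≤ r s a
  r_le_one : ∀ s a, r s a ≤ 1
  p : S → A → S → ℝ
  p_nonneg : ∀ s a s', 0 ≤ p s a s'
  p_sum : ∀ s a, ∑ s', p s a s' = 1

/-- Stationary randomized policies; `π s a` is the probability `π(a|s)`. -/
abbrev Policy (S A : Type*) [Fintype A] := S → stdSimplex ℝ A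

namespace MDP

variable {S A : Type*} [Fintype S] [DecidableEq S] [Nonempty S]
  [Fintype A] [DecidableEq A] [Nonempty A]

/-- The transition matrix `P^π` of the chain induced by `π`. -/
def transition (M : MDP S A) (π : Policy S A) : Matrix S S ℝ :=
  fun s s' => ∑ a, π s a * M.p s a s'

/-- The expected one-step reward `r^π(s)`. -/
def reward (M : MDP S A) (π : Policy S A) (s : S) : ℝ :=
  ∑ a, π s a * M.r s a

/-- Every stationary policy induces an irreducible and aperiodic chain (every state has period one,
that is, only `1` divides all possible return times). -/
def IsErgodic (M : MDP S A) : Prop :=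
  ∀ π : Policy S A, (M.transition π).IsIrreducible ∧
    ∀ s : S, ∀ d : ℕ, (∀ n : ℕ, 1 ≤ n → 0 < (M.transition π ^ n) s s → d ∣ n) → d = 1

/-- The stationary distribution `μ^π` (unique in an ergodic MDP). -/
def stationary (M : MDP S A) (π : Policy S A) : stdSimplex ℝ S :=
  Classical.epsilon fun μ : stdSimplex ℝ S =>
    ∀ s', ∑ s, μ s * M.transition π s s' = μ s'

/-- The long-run average reward `J^π(s)` from the initial state `s`: the lower limit of
`(1/n) 𝔼[∑_{t<n} r(s_t, a_t)]`. In an ergodic MDP it does not depend on `s`. -/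
def avgReward (M : MDP S A) (π : Policy S A) (s : S) : ℝ :=
  liminf (fun n : ℕ => (1 / (n : ℝ)) *
    ∑ t ∈ Finset.range n, ∑ s', (M.transition π ^ t) s s' * M.reward π s') atTop

/-- The relative value function `v^π`: the solution of
`v(s) = r^π(s) - J^π + ∑_{s'} P^π(s, s') v(s')` with `∑_s μ^π(s) v(s) = 0`
(existing and unique in an ergodic MDP). -/
def relValue (M : MDP S A) (π : Policy S A) : S → ℝ :=
  Classical.epsilon fun v : S → ℝ =>
    (∀ s, v s = M.reward π s - M.avgReward π s + ∑ s', M.transition π s s' * v s') ∧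
    ∑ s, M.stationary π s * v s = 0

/-- The action value `q^π(s, a) = r(s, a) + ∑_{s'} p(s'|s, a) v^π(s')`. It solves the Bellman
equation `J^π + q(s, a) = r(s, a) + ∑_{s', a'} p(s'|s, a) π(a'|s') q(s', a')`, whose solutions are
unique up to an additive constant; the constant is fixed by `∑_{s, a} μ^π(s) π(a|s) q(s, a) = J^π`. -/
def qValue (M : MDP S A) (π : Policy S A) (s : S) (a : A) : ℝ :=
  M.r s a + ∑ s', M.p s a s' * M.relValue π s'

/-- The target `β^π(s, a) = q^π(s, a) + N J^π`. -/
def beta (M : MDP S A) (N : ℕ) (π : Policy S A) (s : S) (a : A) : ℝ :=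
  M.qValue π s a + N * M.avgReward π s

/-- The mixing time of one policy: the least `t ≥ 1` such that the `L¹` distance of `(P^π)^t(s, ·)`
to `μ^π` is at most `1/4` for every `s`. -/
def policyMixingTime (M : MDP S A) (π : Policy S A) : ℕ :=
  sInf {t : ℕ | 1 ≤ t ∧
    ∀ s, ∑ s', |(M.transition π ^ t) s s' - M.stationary π s'| ≤ 1 / 4}

/-- The mixing time of the MDP, the maximum over all policies. -/
def mixingTime (M : MDP S A) : ℕ :=
  ⨆ π : Policy S A, M.policyMixingTime π

/-- The hitting time of the MDP, the supremum of `1 / μ^π(s)` over all policies and states. -/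
def hittingTime (M : MDP S A) : ℝ :=
  ⨆ z : Policy S A × S, 1 / M.stationary z.1 z.2

/-! ### The subroutine ESTIMATE-Q

Time is indexed from `0`. A trajectory is given by its states `x` and its actions `y`. -/

/-- The start times of the windows that ESTIMATE-Q records for the target state `s`, when it is at
time `τ` on a trajectory that ends at time `t₂`: while `τ ≤ t₂ - N`, a window is opened and `τ`
increases by `2 N` if `x τ = s`, and otherwise `τ` increases by `1`. The first number bounds
the number of iterations of the loop. -/
def startTimes (N : ℕ) (x : ℕ → S) (s : S) (t₂ : ℕ) : ℕ → ℕ → List ℕ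
  | 0, _ => []
  | fuel + 1, τ =>
    if τ + N ≤ t₂ then
      if x τ = s then τ :: startTimes N x s t₂ fuel (τ + 2 * N)
      else startTimes N x s t₂ fuel (τ + 1)
    else []

/-- The importance-weighted reward of the window `τ, …, τ + N`. -/
def windowEstimate (M : MDP S A) (N : ℕ) (π : Policy S A) (s : S) (x : ℕ → S) (y : ℕ → A)
    (a : A) (τ : ℕ) : ℝ :=
  if y τ = a then (∑ t ∈ Finset.Icc τ (τ + N), M.r (x t) (y t)) / π s a else 0

/-- ESTIMATE-Q on the times `t₁, …, t₂`: the average of the window estimates, and `0` if no window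
was found. For `1 ≤ N` the loop has at most `t₂ + 1 - t₁` iterations. -/
def estimateQ (M : MDP S A) (N : ℕ) (π : Policy S A) (s : S) (x : ℕ → S) (y : ℕ → A)
    (t₁ t₂ : ℕ) (a : A) : ℝ :=
  let L := startTimes N x s t₂ (t₂ + 1 - t₁) t₁
  if L = [] then 0 else (L.map (M.windowEstimate N π s x y a)).sum / L.length

/-! ### The algorithm MDP-OOMD -/

/-- The log-barrier regularizer `ψ(u) = (1/η) ∑_a log (1 / u(a))`, for `u` with positive entries. -/
def logBarrier (η : ℝ) (u : A → ℝ) : ℝ :=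
  1 / η * ∑ a, Real.log (1 / u a)

/-- The Bregman divergence `ψ(u) - ψ(w) - ⟨∇ψ(w), u - w⟩`, where `∇ψ(w)_a = -1 / (η w(a))`. -/
def bregman (η : ℝ) (u w : A → ℝ) : ℝ :=
  logBarrier η u - logBarrier η w - ∑ a, -(1 / (η * w a)) * (u a - w a)

/-- The mirror step `argmax_{u ∈ Δ_A} ⟨u, b⟩ - D_ψ(u, w)`. The maximum is over the `u` with positive
entries, since `ψ` is infinite on the boundary of the simplex. -/
def mirrorStep (η : ℝ) (b : A → ℝ) (w : stdSimplex ℝ A) : stdSimplex ℝ A :=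
  Classical.epsilon fun u : stdSimplex ℝ A => (∀ a, 0 < u a) ∧
    ∀ u' : stdSimplex ℝ A, (∀ a, 0 < u' a) →
      ∑ a, u' a * b a - bregman η u' w ≤ ∑ a, u a * b a - bregman η u w

/-- The estimate of an episode `k = 0, 1, …` that plays the policy `π`. The episode consists of the
times `k B, …, (k + 1) B - 1`. -/
def episodeEstimate (M : MDP S A) (N B : ℕ) (x : ℕ → S) (y : ℕ → A) (k : ℕ) (π : Policy S A)
    (s : S) (a : A) : ℝ :=
  M.estimateQ N π s x y (k * B) ((k + 1) * B - 1) a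

/-- The pair `(π'_k, π_k)` of policies that MDP-OOMD holds in episode `k = 0, 1, …` when it sees the
trajectory `x, y`. It depends only on the trajectory before the episode. -/
def oomdPolicies (M : MDP S A) (η : ℝ) (N B : ℕ) (x : ℕ → S) (y : ℕ → A) :
    ℕ → Policy S A × Policy S A
  | 0 => (fun _ => stdSimplex.barycenter, fun _ => stdSimplex.barycenter)
  | k + 1 =>
    let prev := oomdPolicies M η N B x y k
    let b := M.episodeEstimate N B x y k prev.2
    let base : Policy S A := fun s => mirrorStep η (b s) (prev.1 s)
    (base, fun s => mirrorStep η (b s) (base s))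

/-- The policy `π_k` that MDP-OOMD plays in episode `k`. -/
def oomdPolicy (M : MDP S A) (η : ℝ) (N B : ℕ) (x : ℕ → S) (y : ℕ → A) (k : ℕ) : Policy S A :=
  (M.oomdPolicies η N B x y k).2

/-- The estimator `β̂_k` that MDP-OOMD computes after episode `k`. -/
def betaHat (M : MDP S A) (η : ℝ) (N B : ℕ) (x : ℕ → S) (y : ℕ → A) (k : ℕ) (s : S) (a : A) : ℝ :=
  M.episodeEstimate N B x y k (M.oomdPolicy η N B x y k) s a

/-- The event that the first `n` states are `x 0, …, x (n - 1)` and the first `m` actions are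
`y 0, …, y (m - 1)`. -/
def historyEvent {Ω : Type*} (X : ℕ → Ω → S) (Y : ℕ → Ω → A) (x : ℕ → S) (y : ℕ → A)
    (n m : ℕ) : Set Ω :=
  {ω | (∀ i < n, X i ω = x i) ∧ ∀ i < m, Y i ω = y i}

/-- `X` and `Y` are the states and actions of `T` steps of MDP-OOMD on `M`, from an arbitrary initial
state: given the past, the action at time `t` is drawn from the policy of the current episode,
which is the one with number `t / B`, and the next state from the transition law of the MDP. -/
structure IsOOMDRun (M : MDP S A) (η : ℝ) (N B T : ℕ) {Ω : Type*} [MeasurableSpace Ω]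
    (P : Measure Ω) (X : ℕ → Ω → S) (Y : ℕ → Ω → A) : Prop where
  measurableSet_state : ∀ t s, MeasurableSet (X t ⁻¹' {s})
  measurableSet_action : ∀ t a, MeasurableSet (Y t ⁻¹' {a})
  action : ∀ t < T, ∀ (x : ℕ → S) (y : ℕ → A),
    P.real (historyEvent X Y x y (t + 1) (t + 1)) =
      P.real (historyEvent X Y x y (t + 1) t) * M.oomdPolicy η N B x y (t / B) (x t) (y t)
  state : ∀ t, t + 1 < T → ∀ (x : ℕ → S) (y : ℕ → A),
    P.real (historyEvent X Y x y (t + 2) (t + 1)) =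
      P.real (historyEvent X Y x y (t + 1) (t + 1)) * M.p (x t) (y t) (x (t + 1))

end MDP

end

set_option linter.unusedSectionVars false

/-! ### Finite Markov chains -/

namespace Matrix

variable {S : Type*} [Fintype S] [DecidableEq S] {P : Matrix S S ℝ}

/-! The policy is frozen during an episode and has positive entries, so conditionally on the history
the episode is a Markov chain driven by a fixed policy π, and `IsOOMDRun.integral_betaHat` rewrites
moments of the estimator as values of the recursion `sampleExp`. A window occupies N + 1 steps, and
the search resumes N - 1 steps after it, so the kernel between windows is the (N - 1)-st power of
P^π.

The main obstacle is that the number of windows depends on what was seen inside earlier windows. It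
is removed by replacing the kernel with μ^π, a fresh stationary restart. Mixing gives an additive
error T⁻⁶, and since μ^π ≥ 1/T pointwise this is a relative error T⁻⁵. Relative errors multiply
along the recursion, so over at most T iterations every nonnegative functional changes by a relative
amount of at most 2/T⁴ (`abs_sampleExp_sub_le`).

After independent restarts, the future count is independent of the content of the present window.
Hence, with w the mean of one window, Z the sum and i the number of windows, Z - iw is uncorrelated
with every function of i, and its weighted second moment is at most the one-window variance times
the mean of i g(i) (`sampleExp_sub_mul_add`, `sampleExp_sq_sub_mul_add_le`). The bias then consists
of the restart error, the probability of finding no window, and w - β. The last is a tail of the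
iterated Poisson equation, at most 4^(-⌊N / t_mix⌋) · 2 t_mix.

Counts are controlled by the generating function of i: from any state the target is hit within N
steps with probability at least μ^π(s)/2. At argument 0 this bounds the probability of no window by
T⁻²; at argument 1/2 it bounds the mean of 1/i by a multiple of N / (B μ^π(s)). The one-window
variance is at most (N + 1)² / π(a|s), and the product has order N³ / (B π(a|s) μ^π(s)). -/

theorem mul_apply_le_pow_add_apply (hP : ∀ i j, 0 ≤ P i j) (m n : ℕ) (i j l : S) :
    (P ^ m) i j * (P ^ n) j l ≤ (P ^ (m + n)) i l := by
  rw [pow_add, mul_apply]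
  exact Finset.single_le_sum (f := fun j => (P ^ m) i j * (P ^ n) j l)
    (fun j _ => mul_nonneg (pow_apply_nonneg hP m i j) (pow_apply_nonneg hP n j l))
    (Finset.mem_univ j)

/-- An irreducible nonnegative matrix all of whose states have period one is primitive. -/
theorem IsIrreducible.exists_pow_pos_of_aperiodic (hP : P.IsIrreducible)
    (hper : ∀ s : S, ∀ d : ℕ, (∀ n : ℕ, 1 ≤ n → 0 < (P ^ n) s s → d ∣ n) → d = 1) :
    ∃ n, ∀ i j, 0 < (P ^ n) i j := by
  have hnn := hP.nonneg
  have hret : ∀ s : S, ∃ n, ∀ m ≥ n, 0 < (P ^ m) s s := by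
    intro s
    -- Return times form an additive semigroup with gcd 1, which therefore contains all large
    -- integers.
    have hgcd : Nat.setGcd {n | 1 ≤ n ∧ 0 < (P ^ n) s s} = 1 :=
      hper s _ fun n hn hp => Nat.setGcd_dvd_of_mem (s := {n | 1 ≤ n ∧ 0 < (P ^ n) s s}) ⟨hn, hp⟩
    obtain ⟨n, hn⟩ := Nat.exists_mem_closure_of_ge {n | 1 ≤ n ∧ 0 < (P ^ n) s s}
    refine ⟨n, fun m hm => ?_⟩
    have hmem := hn m hm (by rw [hgcd]; exact one_dvd m)
    clear hm
    induction hmem using AddSubmonoid.closure_induction with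
    | mem x hx => exact hx.2
    | zero => simp
    | add a b _ _ ha hb => exact (mul_pos ha hb).trans_le (mul_apply_le_pow_add_apply hnn a b s s s)
  choose n hn using hret
  choose k _ hk using (isIrreducible_iff_exists_pow_pos hnn).1 hP
  refine ⟨∑ i, n i + ∑ i, ∑ j, k i j, fun i j => ?_⟩
  have h1 : n i ≤ ∑ i, n i := Finset.single_le_sum (fun _ _ => Nat.zero_le _) (Finset.mem_univ i)
  have h2 : k i j ≤ ∑ j, k i j :=
    Finset.single_le_sum (f := fun j => k i j) (fun _ _ => Nat.zero_le _) (Finset.mem_univ j)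
  have h3 : ∑ j, k i j ≤ ∑ i, ∑ j, k i j :=
    Finset.single_le_sum (f := fun i => ∑ j, k i j) (fun _ _ => Nat.zero_le _) (Finset.mem_univ i)
  have h4 := mul_apply_le_pow_add_apply hnn (∑ i, n i + ∑ i, ∑ j, k i j - k i j) (k i j) i i j
  rw [Nat.sub_add_cancel (by omega)] at h4
  exact (mul_pos (hn i _ (by omega)) (hk i j)).trans_le h4

theorem abs_mulVec_le_of_mem_rowStochastic (hP : P ∈ rowStochastic ℝ S) {f : S → ℝ} {c : ℝ}
    (hf : ∀ s, |f s| ≤ c) (s : S) : |(P *ᵥ f) s| ≤ c := by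
  calc |(P *ᵥ f) s| ≤ ∑ j, |P s j * f j| := Finset.abs_sum_le_sum_abs _ _
    _ ≤ ∑ j, P s j * c := Finset.sum_le_sum fun j _ => by
        rw [abs_mul, abs_of_nonneg (hP.1 s j)]
        exact mul_le_mul_of_nonneg_left (hf j) (hP.1 s j)
    _ = c := by rw [← Finset.sum_mul, sum_row_of_mem_rowStochastic hP, one_mul]

/-- A finite stochastic matrix has a stationary distribution. -/
theorem exists_stationary [Nonempty S] (hP : P ∈ rowStochastic ℝ S) :
    ∃ μ : stdSimplex ℝ S, ∀ s', ∑ s, μ s * P s s' = μ s' := by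
  -- The constant vector makes 1 - P singular, so there is also a left kernel vector v. Then |v| ≤
  -- |v|P entrywise with equal total mass, so |v| is itself invariant and can be normalized.
  have h1 : ∃ v : S → ℝ, v ≠ 0 ∧ (1 - P) *ᵥ v = 0 :=
    ⟨1, one_ne_zero, by rw [sub_mulVec, one_mulVec, hP.2, sub_self]⟩
  obtain ⟨v, hv0, hv⟩ := exists_vecMul_eq_zero_iff.2 (exists_mulVec_eq_zero_iff.1 h1)
  have hvP : ∀ s', ∑ s, v s * P s s' = v s' := fun s' => by
    have := congrFun hv s'
    rw [vecMul_sub, vecMul_one, Pi.sub_apply, Pi.zero_apply, sub_eq_zero] at this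
    exact this.symm
  have hle : ∀ s', |v s'| ≤ ∑ s, |v s| * P s s' := fun s' => by
    rw [← hvP s']
    refine (Finset.abs_sum_le_sum_abs _ _).trans_eq (Finset.sum_congr rfl fun s _ => ?_)
    rw [abs_mul, abs_of_nonneg (hP.1 s s')]
  have hsum : ∑ s', |v s'| = ∑ s', ∑ s, |v s| * P s s' := by
    rw [Finset.sum_comm]
    exact Finset.sum_congr rfl fun s _ => by
      rw [← Finset.mul_sum, sum_row_of_mem_rowStochastic hP, mul_one]
  have heq := (Finset.sum_eq_sum_iff_of_le fun s' _ => hle s').1 hsum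
  have hpos : 0 < ∑ s, |v s| := by
    obtain ⟨s, hs⟩ := Function.ne_iff.1 hv0
    exact (abs_pos.2 hs).trans_le
      (Finset.single_le_sum (f := fun s => |v s|) (fun _ _ => abs_nonneg _) (Finset.mem_univ s))
  refine ⟨⟨fun s => |v s| / ∑ s, |v s|, fun s => by positivity, ?_⟩, fun s' => ?_⟩
  · rw [← Finset.sum_div, div_self hpos.ne']
  · change ∑ s, |v s| / (∑ s, |v s|) * P s s' = |v s'| / ∑ s, |v s|
    rw [heq s' (Finset.mem_univ _), Finset.sum_div]
    exact Finset.sum_congr rfl fun s _ => by ring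

theorem vecMul_pow_of_stationary {μ : S → ℝ} (hμ : μ ᵥ* P = μ) (n : ℕ) : μ ᵥ* (P ^ n) = μ := by
  induction n with
  | zero => simp
  | succ n ih => rw [pow_succ, ← vecMul_vecMul, ih, hμ]

theorem dotProduct_pow_mulVec_of_stationary {μ : S → ℝ} (hμ : μ ᵥ* P = μ) (n : ℕ) (f : S → ℝ) :
    μ ⬝ᵥ ((P ^ n) *ᵥ f) = μ ⬝ᵥ f := by
  rw [dotProduct_mulVec, vecMul_pow_of_stationary hμ]

/-- If `P ^ t` contracts centred functions by the factor `ρ`, then `P ^ n` contracts them by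
`ρ ^ (n / t)`. -/
theorem abs_pow_mulVec_le_of_contraction (hP : P ∈ rowStochastic ℝ S) {μ : S → ℝ}
    (hμ : μ ᵥ* P = μ) {t : ℕ} {ρ : ℝ}
    (h : ∀ (f : S → ℝ) (c : ℝ), μ ⬝ᵥ f = 0 → (∀ s, |f s| ≤ c) → ∀ s, |((P ^ t) *ᵥ f) s| ≤ ρ * c)
    (n : ℕ) {f : S → ℝ} {c : ℝ} (hf : μ ⬝ᵥ f = 0) (hc : ∀ s, |f s| ≤ c) (s : S) :
    |((P ^ n) *ᵥ f) s| ≤ ρ ^ (n / t) * c := by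
  have key : ∀ (j : ℕ) (s : S), |((P ^ (t * j)) *ᵥ f) s| ≤ ρ ^ j * c := by
    intro j
    induction j with
    | zero => simpa using hc
    | succ j ih =>
      intro s
      rw [mul_add, mul_one, add_comm, pow_add, ← mulVec_mulVec, pow_succ', mul_assoc]
      exact h _ _ (by rw [dotProduct_pow_mulVec_of_stationary hμ, hf]) ih s
  rw [← Nat.mod_add_div n t, pow_add, ← mulVec_mulVec, Nat.mod_add_div]
  exact abs_mulVec_le_of_mem_rowStochastic (pow_mem hP _) (key _) s

/-- Doeblin's condition: a stochastic matrix with entries at least `ε` contracts centred functions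
by the factor `1 - ε`. -/
theorem abs_mulVec_le_of_le_apply (hP : P ∈ rowStochastic ℝ S) {μ : S → ℝ}
    (hμ1 : ∑ s, μ s = 1) (hμle : ∀ s, μ s ≤ 1) {ε : ℝ} (hε : 0 ≤ ε) (h : ∀ s s', ε ≤ P s s')
    (f : S → ℝ) (c : ℝ) (hf : μ ⬝ᵥ f = 0) (hc : ∀ s, |f s| ≤ c) (s : S) :
    |(P *ᵥ f) s| ≤ (1 - ε) * c := by
  -- Since f is centred, εμ can be subtracted from each row; what remains is nonnegative with mass 1
  -- - ε.
  have h1 : (P *ᵥ f) s = ∑ j, (P s j - ε * μ j) * f j := by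
    simp only [sub_mul, Finset.sum_sub_distrib, mul_assoc, ← Finset.mul_sum]
    rw [show ∑ j, μ j * f j = 0 from hf]
    simp [mulVec, dotProduct]
  have h0 : ∀ j, 0 ≤ P s j - ε * μ j := fun j => by
    nlinarith [h s j, hμle j]
  rw [h1]
  calc |∑ j, (P s j - ε * μ j) * f j| ≤ ∑ j, |(P s j - ε * μ j) * f j| :=
        Finset.abs_sum_le_sum_abs _ _
    _ ≤ ∑ j, (P s j - ε * μ j) * c := Finset.sum_le_sum fun j _ => by
        rw [abs_mul, abs_of_nonneg (h0 j)]
        exact mul_le_mul_of_nonneg_left (hc j) (h0 j)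
    _ = (1 - ε) * c := by
        rw [← Finset.sum_mul, Finset.sum_sub_distrib, ← Finset.mul_sum, hμ1,
          sum_row_of_mem_rowStochastic hP, mul_one]

/-- If the rows of `P` are within `ρ` of `μ` in `L¹`, then `P` contracts centred functions by `ρ`. -/
theorem abs_mulVec_le_of_sum_abs_sub_le {μ : S → ℝ} {ρ : ℝ}
    (h : ∀ s, ∑ s', |P s s' - μ s'| ≤ ρ)
    (f : S → ℝ) (c : ℝ) (hf : μ ⬝ᵥ f = 0) (hc : ∀ s, |f s| ≤ c) (s : S) :
    |(P *ᵥ f) s| ≤ ρ * c := by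
  have h1 : (P *ᵥ f) s = ∑ j, (P s j - μ j) * f j := by
    simp only [sub_mul, Finset.sum_sub_distrib]
    rw [show ∑ j, μ j * f j = 0 from hf, sub_zero]
    rfl
  have hc0 : 0 ≤ c := (abs_nonneg _).trans (hc s)
  rw [h1]
  calc |∑ j, (P s j - μ j) * f j| ≤ ∑ j, |(P s j - μ j) * f j| :=
        Finset.abs_sum_le_sum_abs _ _
    _ ≤ ∑ j, |P s j - μ j| * c := Finset.sum_le_sum fun j _ => by
        rw [abs_mul]
        exact mul_le_mul_of_nonneg_left (hc j) (abs_nonneg _)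
    _ ≤ ρ * c := by
        rw [← Finset.sum_mul]
        exact mul_le_mul_of_nonneg_right (h s) hc0

/-- Turns contraction of centred functions into bounds on single entries, by means of a centred
indicator. -/
theorem pow_mulVec_single_sub (hP : P ∈ rowStochastic ℝ S) (μ : S → ℝ) (n : ℕ) (s s' : S) :
    ((P ^ n) *ᵥ fun u => (if u = s' then 1 else 0) - μ s') s = (P ^ n) s s' - μ s' := by
  simp only [mulVec, dotProduct, mul_sub, Finset.sum_sub_distrib, ← Finset.sum_mul,
    sum_row_of_mem_rowStochastic (pow_mem hP n)]
  simp

theorem abs_pow_apply_sub_le (hP : P ∈ rowStochastic ℝ S) (μ : stdSimplex ℝ S) {n : ℕ} {ρ : ℝ}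
    (h : ∀ (f : S → ℝ) (c : ℝ), μ ⬝ᵥ f = 0 → (∀ s, |f s| ≤ c) → ∀ s, |((P ^ n) *ᵥ f) s| ≤ ρ * c)
    (s s' : S) : |(P ^ n) s s' - μ s'| ≤ ρ := by
  rw [← pow_mulVec_single_sub hP μ]
  refine (h _ 1 ?_ (fun u => ?_) s).trans_eq (mul_one ρ)
  · simp only [dotProduct, mul_sub, Finset.sum_sub_distrib, ← Finset.sum_mul]
    rw [show ∑ i, μ i = 1 from μ.2.2]
    simp
  · have h0 : 0 ≤ μ s' := μ.2.1 s'
    have h1 : μ s' ≤ 1 := stdSimplex.le_one μ s'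
    split_ifs <;> rw [abs_le] <;> constructor <;> linarith

end Matrix

/-! ### Uniform mixing of an ergodic MDP -/

namespace MDP

open Matrix

variable {S A : Type*} [Fintype S] [DecidableEq S] [Nonempty S]
  [Fintype A] [DecidableEq A] [Nonempty A] (M : MDP S A)

theorem transition_mem_rowStochastic (π : Policy S A) :
    M.transition π ∈ rowStochastic ℝ S := by
  rw [mem_rowStochastic_iff_sum]
  refine ⟨fun s s' => Finset.sum_nonneg fun a _ => mul_nonneg ((π s).2.1 a) (M.p_nonneg s a s'),
    fun s => ?_⟩
  simp only [transition]
  rw [Finset.sum_comm]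
  simp only [← Finset.mul_sum, M.p_sum, mul_one]
  exact (π s).2.2

theorem stationary_spec (π : Policy S A) (s' : S) :
    ∑ s, M.stationary π s * M.transition π s s' = M.stationary π s' :=
  Classical.epsilon_spec (exists_stationary (M.transition_mem_rowStochastic π)) s'

theorem stationary_vecMul (π : Policy S A) :
    (M.stationary π : S → ℝ) ᵥ* M.transition π = M.stationary π :=
  funext (M.stationary_spec π)

theorem continuous_transition_apply (s s' : S) :
    Continuous fun π : Policy S A => M.transition π s s' := by
  unfold transition
  refine continuous_finsetSum _ fun a _ => Continuous.mul ?_ continuous_const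
  exact (continuous_apply a).comp (continuous_subtype_val.comp (continuous_apply s))

theorem continuous_transition_pow_apply (n : ℕ) (s s' : S) :
    Continuous fun π : Policy S A => (M.transition π ^ n) s s' := by
  have h : Continuous fun π : Policy S A => M.transition π ^ n :=
    Continuous.pow (continuous_matrix fun i j => M.continuous_transition_apply i j) n
  exact h.matrix_elem s s'

variable {M}

/-- Locally uniform positivity of some power of the transition matrix. -/
theorem IsErgodic.exists_eventually_le (hM : M.IsErgodic) (π₀ : Policy S A) :
    ∃ (n : ℕ) (ε : ℝ), 0 < ε ∧ ∀ᶠ π in nhds π₀, ∀ s s', ε ≤ (M.transition π ^ n) s s' := by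
  obtain ⟨n, hn⟩ := (hM π₀).1.exists_pow_pos_of_aperiodic (hM π₀).2
  obtain ⟨ε, hε0, hε⟩ : ∃ ε : ℝ, 0 < ε ∧ ∀ z : S × S, ε < (M.transition π₀ ^ n) z.1 z.2 := by
    have h : ∀ᶠ ε in nhdsWithin (0 : ℝ) (Set.Ioi 0),
        ∀ z : S × S, ε < (M.transition π₀ ^ n) z.1 z.2 :=
      eventually_all.2 fun z =>
        nhdsWithin_le_nhds (Iio_mem_nhds (hn z.1 z.2))
    obtain ⟨ε, h1, h2⟩ := (h.and self_mem_nhdsWithin).exists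
    exact ⟨ε, h2, h1⟩
  refine ⟨n, ε, hε0, eventually_all.2 fun s => eventually_all.2 fun s' => ?_⟩
  exact ((M.continuous_transition_pow_apply n s s').continuousAt.eventually
    (lt_mem_nhds (hε (s, s')))).mono fun _ h => le_of_lt h

theorem le_stationary_of_le_pow {π : Policy S A} {n : ℕ} {ε : ℝ}
    (h : ∀ s s', ε ≤ (M.transition π ^ n) s s') (s' : S) : ε ≤ M.stationary π s' := by
  have h1 := congrFun (vecMul_pow_of_stationary (M.stationary_vecMul π) n) s'
  calc ε = ∑ s, M.stationary π s * ε := by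
        rw [← Finset.sum_mul, show ∑ s, M.stationary π s = 1 from (M.stationary π).2.2, one_mul]
    _ ≤ ∑ s, M.stationary π s * (M.transition π ^ n) s s' := Finset.sum_le_sum fun s _ =>
        mul_le_mul_of_nonneg_left (h s s') ((M.stationary π).2.1 s)
    _ = M.stationary π s' := h1

theorem IsErgodic.stationary_pos (hM : M.IsErgodic) (π : Policy S A) (s : S) :
    0 < M.stationary π s := by
  obtain ⟨n, ε, hε, h⟩ := hM.exists_eventually_le π
  exact hε.trans_le (le_stationary_of_le_pow h.self_of_nhds s)

/-- Doeblin contraction. The time `t` depends on `n` and `ε` but not on the policy, as the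
compactness argument requires. -/
theorem sum_abs_sub_stationary_le_of_le_pow {n : ℕ} {ε : ℝ} (hε : 0 < ε) :
    ∃ t ≥ 1, ∀ π : Policy S A, (∀ s s', ε ≤ (M.transition π ^ n) s s') →
      ∀ s, ∑ s', |(M.transition π ^ t) s s' - M.stationary π s'| ≤ 1 / 4 := by
  by_cases hε1 : ε ≤ 1
  swap
  · refine ⟨1, le_rfl, fun π h => ?_⟩
    obtain ⟨s⟩ := ‹Nonempty S›
    exact absurd ((h s s).trans (le_one_of_mem_rowStochastic
      (pow_mem (M.transition_mem_rowStochastic π) n))) hε1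
  -- The L¹ distance has |S| terms, whence the factor 1 / (4|S|). The shifts `n + 1` and `j + 1`
  -- below keep the time positive.
  obtain ⟨j, hj⟩ := exists_pow_lt_of_lt_one (y := 1 - ε) (x := 1 / (4 * (Fintype.card S : ℝ)))
    (by positivity) (by linarith)
  refine ⟨(n + 1) * (j + 1), Nat.le_mul_of_pos_right _ (by omega) |>.trans' (by omega), fun π h s => ?_⟩
  have hP := M.transition_mem_rowStochastic π
  have hc : ∀ (f : S → ℝ) (c : ℝ), M.stationary π ⬝ᵥ f = 0 → (∀ s, |f s| ≤ c) →
      ∀ s, |((M.transition π ^ (n + 1)) *ᵥ f) s| ≤ (1 - ε) * c := by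
    intro f c hf hc
    rw [pow_succ', ← mulVec_mulVec]
    exact abs_mulVec_le_of_mem_rowStochastic hP (abs_mulVec_le_of_le_apply (pow_mem hP n)
      (M.stationary π).2.2 (fun s => stdSimplex.le_one _ s) hε.le h f c hf hc)
  have hd : ∀ s', |(M.transition π ^ ((n + 1) * (j + 1))) s s' - M.stationary π s'|
      ≤ (1 - ε) ^ (j + 1) := fun s' => by
    refine abs_pow_apply_sub_le hP _ (fun f c hf hfc s => ?_) s s'
    have := abs_pow_mulVec_le_of_contraction hP (M.stationary_vecMul π) hc
      ((n + 1) * (j + 1)) hf hfc s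
    rwa [Nat.mul_div_cancel_left _ (by omega)] at this
  have hcard : (0 : ℝ) < Fintype.card S := by positivity
  calc _ ≤ ∑ _s' : S, (1 - ε) ^ (j + 1) := Finset.sum_le_sum fun s' _ => hd s'
    _ = Fintype.card S * (1 - ε) ^ (j + 1) := by simp
    _ ≤ Fintype.card S * (1 / (4 * Fintype.card S)) := by
        refine mul_le_mul_of_nonneg_left (le_trans ?_ hj.le) hcard.le
        rw [pow_succ]
        exact mul_le_of_le_one_right (pow_nonneg (by linarith) _) (by linarith)
    _ = 1 / 4 := by field_simp

/-- Mixing times and inverse stationary probabilities of an ergodic MDP are uniformly bounded. -/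
theorem IsErgodic.exists_uniform_bounds (hM : M.IsErgodic) :
    ∃ (T : ℕ) (ε : ℝ), 0 < ε ∧ ∀ π : Policy S A,
      (∃ t, 1 ≤ t ∧ t ≤ T ∧
        ∀ s, ∑ s', |(M.transition π ^ t) s s' - M.stationary π s'| ≤ 1 / 4) ∧
      ∀ s, ε ≤ M.stationary π s := by
  choose n ε hε hU using hM.exists_eventually_le
  choose t ht1 ht using fun π₀ => sum_abs_sub_stationary_le_of_le_pow (M := M) (n := n π₀) (hε π₀)
  -- The policy space is a product of simplices, hence compact; finitely many neighbourhoods with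
  -- uniform constants cover it.
  obtain ⟨F, -, hF⟩ := isCompact_univ.elim_nhds_subcover _ fun π₀ (_ : π₀ ∈ Set.univ) => hU π₀
  have hFne : F.Nonempty := by
    obtain ⟨π₀, hπ₀, -⟩ := Set.mem_iUnion₂.1 (hF (Set.mem_univ (fun _ => stdSimplex.barycenter)))
    exact ⟨π₀, hπ₀⟩
  refine ⟨F.sup t, F.inf' hFne ε, (Finset.lt_inf'_iff _).2 fun π _ => hε π, fun π => ?_⟩
  obtain ⟨π₀, hπ₀, hπ⟩ := Set.mem_iUnion₂.1 (hF (Set.mem_univ π))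
  exact ⟨⟨t π₀, ht1 π₀, Finset.le_sup hπ₀, ht π₀ π hπ⟩,
    fun s => (Finset.inf'_le ε hπ₀).trans (le_stationary_of_le_pow hπ s)⟩

theorem IsErgodic.policyMixingTime_spec (hM : M.IsErgodic) (π : Policy S A) :
    1 ≤ M.policyMixingTime π ∧
      ∀ s, ∑ s', |(M.transition π ^ M.policyMixingTime π) s s' - M.stationary π s'| ≤ 1 / 4 := by
  obtain ⟨T, ε, -, h⟩ := hM.exists_uniform_bounds
  obtain ⟨t, ht1, -, ht⟩ := (h π).1
  exact Nat.sInf_mem (s := {t : ℕ | 1 ≤ t ∧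
    ∀ s, ∑ s', |(M.transition π ^ t) s s' - M.stationary π s'| ≤ 1 / 4}) ⟨t, ht1, ht⟩

theorem IsErgodic.policyMixingTime_le (hM : M.IsErgodic) (π : Policy S A) :
    M.policyMixingTime π ≤ M.mixingTime := by
  obtain ⟨T, ε, -, h⟩ := hM.exists_uniform_bounds
  -- An unbounded supremum would take the default value 0, so boundedness is what gives `mixingTime`
  -- its meaning.
  have hb : BddAbove (Set.range M.policyMixingTime) := by
    refine ⟨T, ?_⟩
    rintro _ ⟨π, rfl⟩
    obtain ⟨t, ht1, htT, ht⟩ := (h π).1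
    exact le_trans (Nat.sInf_le ⟨ht1, ht⟩) htT
  exact le_ciSup hb π

theorem IsErgodic.one_le_mixingTime (hM : M.IsErgodic) : 1 ≤ M.mixingTime :=
  (hM.policyMixingTime_spec fun _ => stdSimplex.barycenter).1.trans (hM.policyMixingTime_le _)

theorem IsErgodic.one_div_stationary_le (hM : M.IsErgodic) (π : Policy S A) (s : S) :
    1 / M.stationary π s ≤ M.hittingTime := by
  obtain ⟨T, ε, hε, h⟩ := hM.exists_uniform_bounds
  have hb : BddAbove (Set.range fun z : Policy S A × S => 1 / M.stationary z.1 z.2) := by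
    refine ⟨1 / ε, ?_⟩
    rintro _ ⟨z, rfl⟩
    exact one_div_le_one_div_of_le hε ((h z.1).2 z.2)
  exact le_ciSup hb (π, s)

theorem IsErgodic.one_le_stationary_mul_hittingTime (hM : M.IsErgodic) (π : Policy S A) (s : S) :
    1 ≤ M.stationary π s * M.hittingTime := by
  have h := hM.one_div_stationary_le π s
  rwa [div_le_iff₀' (hM.stationary_pos π s)] at h

/-- Powers of the transition matrix contract centred functions geometrically. -/
theorem IsErgodic.abs_pow_mulVec_le (hM : M.IsErgodic) (π : Policy S A) (n : ℕ) {f : S → ℝ} {c : ℝ}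
    (hf : M.stationary π ⬝ᵥ f = 0) (hc : ∀ s, |f s| ≤ c) (s : S) :
    |((M.transition π ^ n) *ᵥ f) s| ≤ (1 / 4) ^ (n / M.mixingTime) * c := by
  have hc0 : 0 ≤ c := (abs_nonneg _).trans (hc s)
  refine (abs_pow_mulVec_le_of_contraction (M.transition_mem_rowStochastic π)
    (M.stationary_vecMul π)
    (abs_mulVec_le_of_sum_abs_sub_le (hM.policyMixingTime_spec π).2) n hf hc s).trans ?_
  refine mul_le_mul_of_nonneg_right (pow_le_pow_of_le_one (by norm_num) (by norm_num) ?_) hc0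
  exact Nat.div_le_div_left (hM.policyMixingTime_le π) (hM.policyMixingTime_spec π).1

theorem IsErgodic.abs_pow_apply_sub_stationary_le (hM : M.IsErgodic) (π : Policy S A) (n : ℕ)
    (s s' : S) :
    |(M.transition π ^ n) s s' - M.stationary π s'| ≤ (1 / 4) ^ (n / M.mixingTime) :=
  abs_pow_apply_sub_le (M.transition_mem_rowStochastic π) _
    (fun _ _ hf hc => hM.abs_pow_mulVec_le π n hf hc) s s'

/-! ### The average reward and the relative value function -/

theorem reward_nonneg (M : MDP S A) (π : Policy S A) (s : S) : 0 ≤ M.reward π s :=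
  Finset.sum_nonneg fun a _ => mul_nonneg ((π s).2.1 a) (M.r_nonneg s a)

theorem reward_le_one (M : MDP S A) (π : Policy S A) (s : S) : M.reward π s ≤ 1 := by
  refine (Finset.sum_le_sum fun a _ =>
    mul_le_of_le_one_right ((π s).2.1 a) (M.r_le_one s a)).trans_eq ?_
  exact (π s).2.2

theorem stationary_dotProduct_nonneg (π : Policy S A) :
    0 ≤ M.stationary π ⬝ᵥ M.reward π :=
  Finset.sum_nonneg fun s _ => mul_nonneg ((M.stationary π).2.1 s) (M.reward_nonneg π s)

theorem stationary_dotProduct_le_one (π : Policy S A) :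
    M.stationary π ⬝ᵥ M.reward π ≤ 1 := by
  refine (Finset.sum_le_sum fun s _ =>
    mul_le_of_le_one_right ((M.stationary π).2.1 s) (M.reward_le_one π s)).trans_eq ?_
  exact (M.stationary π).2.2

theorem dotProduct_sub_const (π : Policy S A) (f : S → ℝ) (c : ℝ) :
    M.stationary π ⬝ᵥ (fun s => f s - c) = M.stationary π ⬝ᵥ f - c := by
  simp only [dotProduct, mul_sub, Finset.sum_sub_distrib, ← Finset.sum_mul]
  rw [show ∑ s, M.stationary π s = 1 from (M.stationary π).2.2, one_mul]

theorem pow_mulVec_sub_const (π : Policy S A) (n : ℕ) (f : S → ℝ) (c : ℝ) (s : S) :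
    ((M.transition π ^ n) *ᵥ (fun s => f s - c)) s = ((M.transition π ^ n) *ᵥ f) s - c := by
  simp only [mulVec, dotProduct, mul_sub, Finset.sum_sub_distrib, ← Finset.sum_mul]
  rw [sum_row_of_mem_rowStochastic (pow_mem (M.transition_mem_rowStochastic π) n), one_mul]

theorem IsErgodic.tendsto_pow_mulVec (hM : M.IsErgodic) (π : Policy S A) (f : S → ℝ) (s : S) :
    Tendsto (fun n => ((M.transition π ^ n) *ᵥ f) s) atTop (nhds (M.stationary π ⬝ᵥ f)) := by
  have hentry : ∀ s', Tendsto (fun n => (M.transition π ^ n) s s') atTop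
      (nhds (M.stationary π s')) := fun s' => by
    rw [tendsto_iff_norm_sub_tendsto_zero]
    refine squeeze_zero (fun _ => norm_nonneg _)
      (fun n => hM.abs_pow_apply_sub_stationary_le π n s s') ?_
    exact (tendsto_pow_atTop_nhds_zero_of_lt_one (by norm_num) (by norm_num)).comp
      (Nat.tendsto_div_const_atTop (Nat.one_le_iff_ne_zero.1 hM.one_le_mixingTime))
  exact tendsto_finsetSum _ fun s' _ => (hentry s').mul_const _

/-- The expected rewards converge, so their Cesàro means converge to the same limit and the lower
limit is a limit. -/
theorem IsErgodic.avgReward_eq (hM : M.IsErgodic) (π : Policy S A) (s : S) :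
    M.avgReward π s = M.stationary π ⬝ᵥ M.reward π := by
  refine Tendsto.liminf_eq ?_
  have := (hM.tendsto_pow_mulVec π (M.reward π) s).cesaro
  simpa [mulVec, dotProduct] using this

/-- The map v ↦ v - Pv + (μ·v)1 is injective: a kernel vector satisfies μ·v = 0 and Pv = v, so v =
Pⁿv tends to μ·v = 0. In finite dimension it is onto, and a preimage of r - J is the required v. -/
theorem IsErgodic.exists_relValue (hM : M.IsErgodic) (π : Policy S A) :
    ∃ v : S → ℝ, (∀ s, v s = M.reward π s - M.avgReward π s + ∑ s', M.transition π s s' * v s') ∧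
      ∑ s, M.stationary π s * v s = 0 := by
  set P := M.transition π
  set μ : S → ℝ := fun s => M.stationary π s with hμdef
  have hμ1 : ∑ s, μ s = 1 := (M.stationary π).2.2
  have hμP : μ ᵥ* P = μ := M.stationary_vecMul π
  have hdot : ∀ v : S → ℝ, μ ⬝ᵥ (v - P *ᵥ v + fun _ => μ ⬝ᵥ v) = μ ⬝ᵥ v := fun v => by
    have h1 : μ ⬝ᵥ (fun _ : S => μ ⬝ᵥ v) = μ ⬝ᵥ v := by
      conv_lhs => rw [dotProduct, ← Finset.sum_mul, hμ1, one_mul]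
    rw [dotProduct_add, dotProduct_sub, dotProduct_mulVec, hμP, sub_self, zero_add, h1]
  let F : (S → ℝ) →ₗ[ℝ] (S → ℝ) :=
    { toFun := fun v => v - P *ᵥ v + fun _ => μ ⬝ᵥ v
      map_add' := fun v w => by
        ext s
        simp only [mulVec_add, dotProduct_add, Pi.add_apply, Pi.sub_apply]
        ring
      map_smul' := fun c v => by
        ext s
        simp only [mulVec_smul, dotProduct_smul, Pi.add_apply, Pi.sub_apply, Pi.smul_apply,
          smul_eq_mul, RingHom.id_apply]
        ring }
  have hinj : Function.Injective F := by
    rw [injective_iff_map_eq_zero]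
    intro v hv
    have hv' : v - P *ᵥ v + (fun _ => μ ⬝ᵥ v) = 0 := hv
    have hμv : μ ⬝ᵥ v = 0 := by rw [← hdot v, hv', dotProduct_zero]
    have hPv : P *ᵥ v = v := by
      ext s
      have := congrFun hv' s
      simp only [hμv, Pi.add_apply, Pi.sub_apply, Pi.zero_apply, add_zero] at this
      linarith
    have hpow : ∀ n, (P ^ n) *ᵥ v = v := fun n => by
      induction n with
      | zero => simp
      | succ n ih => rw [pow_succ, ← mulVec_mulVec, hPv, ih]
    ext s
    have := hM.tendsto_pow_mulVec π v s
    have h2 : Tendsto (fun n => ((P ^ n) *ᵥ v) s) atTop (nhds (v s)) := by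
      simp only [hpow]
      exact tendsto_const_nhds
    rw [tendsto_nhds_unique h2 this]
    exact hμv
  obtain ⟨v, hv⟩ := LinearMap.injective_iff_surjective.1 hinj
    (fun s => M.reward π s - μ ⬝ᵥ M.reward π)
  have hv' : v - P *ᵥ v + (fun _ => μ ⬝ᵥ v) = fun s => M.reward π s - μ ⬝ᵥ M.reward π := hv
  have hμv : μ ⬝ᵥ v = 0 := by
    rw [← hdot v, hv', hμdef, M.dotProduct_sub_const, sub_self]
  refine ⟨v, fun s => ?_, hμv⟩
  have := congrFun hv' s
  simp only [hμv, Pi.add_apply, Pi.sub_apply, add_zero] at this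
  rw [hM.avgReward_eq]
  change v s = _ + (P *ᵥ v) s
  linarith

theorem IsErgodic.relValue_spec (hM : M.IsErgodic) (π : Policy S A) :
    (∀ s, M.relValue π s = M.reward π s - M.stationary π ⬝ᵥ M.reward π +
      (M.transition π *ᵥ M.relValue π) s) ∧ M.stationary π ⬝ᵥ M.relValue π = 0 := by
  have h := Classical.epsilon_spec (hM.exists_relValue π)
  refine ⟨fun s => ?_, h.2⟩
  rw [← hM.avgReward_eq π s]
  exact h.1 s

/-- The Poisson equation iterated n times. The finite sum is what a window of rewards measures; the
last term is its bias. -/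
theorem IsErgodic.relValue_eq_sum_add (hM : M.IsErgodic) (π : Policy S A) (n : ℕ) (s : S) :
    M.relValue π s = ∑ j ∈ Finset.range n,
      (((M.transition π ^ j) *ᵥ M.reward π) s - M.stationary π ⬝ᵥ M.reward π) +
        ((M.transition π ^ n) *ᵥ M.relValue π) s := by
  induction n with
  | zero => simp
  | succ n ih =>
    have h1 : M.relValue π = fun s => (M.reward π + M.transition π *ᵥ M.relValue π) s -
        M.stationary π ⬝ᵥ M.reward π := by
      ext s
      rw [(hM.relValue_spec π).1 s, Pi.add_apply]
      ring
    rw [Finset.sum_range_succ, ih]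
    have h2 := congrFun (congrArg (fun v => (M.transition π ^ n) *ᵥ v) h1) s
    rw [pow_mulVec_sub_const, mulVec_add, Pi.add_apply, mulVec_mulVec, ← pow_succ] at h2
    linarith

/-- Over one mixing time the rewards contribute at most t and the remainder contracts by 1/4; at a
maximizer of |v| this reads |v| ≤ t + |v|/4. -/
theorem IsErgodic.abs_relValue_le (hM : M.IsErgodic) (π : Policy S A) (s : S) :
    |M.relValue π s| ≤ 2 * M.mixingTime := by
  set v := M.relValue π
  set t := M.mixingTime
  have ht := hM.one_le_mixingTime
  obtain ⟨s₀, hs₀⟩ := Finite.exists_max fun s => |v s|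
  have h1 := hM.relValue_eq_sum_add π t s₀
  have h2 := hM.abs_pow_mulVec_le π t (hM.relValue_spec π).2 hs₀ s₀
  rw [Nat.div_self ht, pow_one] at h2
  have h3 : |∑ j ∈ Finset.range t,
      (((M.transition π ^ j) *ᵥ M.reward π) s₀ - M.stationary π ⬝ᵥ M.reward π)| ≤ t := by
    refine (Finset.abs_sum_le_sum_abs _ _).trans ?_
    refine (Finset.sum_le_card_nsmul _ _ 1 fun j _ => ?_).trans_eq (by simp)
    rw [abs_le]
    have h4 := nonneg_mulVec_of_mem_rowStochastic
      (pow_mem (M.transition_mem_rowStochastic π) j) (M.reward_nonneg π) s₀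
    have h5 := abs_le.1 (abs_mulVec_le_of_mem_rowStochastic
      (pow_mem (M.transition_mem_rowStochastic π) j) (f := M.reward π) (c := 1)
      (fun s => abs_le.2 ⟨by linarith [M.reward_nonneg π s], M.reward_le_one π s⟩) s₀)
    have h6 := M.stationary_dotProduct_nonneg π
    have h7 := M.stationary_dotProduct_le_one π
    constructor <;> linarith [h5.2]
  have h4 : |v s₀| ≤ t + 1 / 4 * |v s₀| := by
    calc |v s₀| ≤ _ := by
          conv_lhs => rw [show v s₀ = _ from h1]
          exact abs_add_le _ _
      _ ≤ _ := add_le_add h3 h2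
  have h5 := hs₀ s
  have h6 : (0 : ℝ) ≤ t := Nat.cast_nonneg _
  linarith

end MDP

/-! ### The policies of MDP-OOMD -/

namespace MDP

variable {S A : Type*} [Fintype S] [DecidableEq S] [Nonempty S]
  [Fintype A] [DecidableEq A] [Nonempty A] (M : MDP S A)

theorem continuousOn_mirror_objective (η : ℝ) (b w : A → ℝ) :
    ContinuousOn (fun u : stdSimplex ℝ A => ∑ a, u a * b a - bregman η u w)
      {u | ∀ a, 0 < u a} := by
  have hc : ∀ a, Continuous fun u : stdSimplex ℝ A => u a := fun a =>
    (continuous_apply a).comp continuous_subtype_val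
  unfold bregman logBarrier
  refine ContinuousOn.sub ?_ (ContinuousOn.sub (ContinuousOn.sub ?_ continuousOn_const) ?_)
  · exact (continuous_finsetSum _ fun a _ => (hc a).mul continuous_const).continuousOn
  · refine continuousOn_const.mul (continuousOn_finsetSum _ fun a _ => ?_)
    refine ContinuousOn.log (continuousOn_const.div (hc a).continuousOn fun u hu => (hu a).ne')
      fun u hu => (one_div_pos.2 (hu a)).ne'
  · exact (continuous_finsetSum _ fun a _ =>
      continuous_const.mul ((hc a).sub continuous_const)).continuousOn

/-- The maximum in the mirror step is attained. -/
theorem exists_mirrorStep {η : ℝ} (hη : 0 < η) (b : A → ℝ) (w : stdSimplex ℝ A) :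
    ∃ u : stdSimplex ℝ A, (∀ a, 0 < u a) ∧
      ∀ u' : stdSimplex ℝ A, (∀ a, 0 < u' a) →
        ∑ a, u' a * b a - bregman η u' w ≤ ∑ a, u a * b a - bregman η u w := by
  set Φ : stdSimplex ℝ A → ℝ := fun u => ∑ a, u a * b a - bregman η u w with hΦ
  have hc : ∀ a, Continuous fun u : stdSimplex ℝ A => u a := fun a =>
    (continuous_apply a).comp continuous_subtype_val
  -- `Φ` is a barrier plus a function that is continuous on the whole simplex
  let l : stdSimplex ℝ A → ℝ := fun u =>
    ∑ a, u a * b a + logBarrier η w + ∑ a, -(1 / (η * w a)) * (u a - w a)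
  have hl : Continuous l := by
    refine Continuous.add (Continuous.add ?_ continuous_const) ?_
    · exact continuous_finsetSum _ fun a _ => (hc a).mul continuous_const
    · exact continuous_finsetSum _ fun a _ => continuous_const.mul ((hc a).sub continuous_const)
  have hΦl : ∀ u, Φ u = l u + 1 / η * ∑ a, Real.log (u a) := fun u => by
    simp only [hΦ, l, bregman, logBarrier, one_div, Real.log_inv, Finset.sum_neg_distrib]
    ring
  obtain ⟨u₁, -, hu₁⟩ := isCompact_univ.exists_isMaxOn
    (Set.univ_nonempty (α := stdSimplex ℝ A)) hl.continuousOn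
  let u₀ : stdSimplex ℝ A := stdSimplex.barycenter
  have hu₀ : ∀ a, 0 < u₀ a := fun a => by
    change (0 : ℝ) < (Fintype.card A : ℝ)⁻¹
    positivity
  -- A coordinate below the first term makes the barrier so negative that the objective is at most
  -- its value at the barycenter; the second term keeps the barycenter in the compact set.
  set δ : ℝ := min (Real.exp (η * (Φ u₀ - l u₁))) (Fintype.card A : ℝ)⁻¹ with hδ
  have hδ0 : 0 < δ := lt_min (Real.exp_pos _) (by positivity)
  have hK : IsCompact {u : stdSimplex ℝ A | ∀ a, δ ≤ u a} := by
    refine IsClosed.isCompact ?_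
    simp only [Set.ofPred_forall]
    exact isClosed_iInter fun a => isClosed_le continuous_const (hc a)
  have hsub : {u : stdSimplex ℝ A | ∀ a, δ ≤ u a} ⊆ {u | ∀ a, 0 < u a} :=
    fun u hu a => hδ0.trans_le (hu a)
  have hu₀K : u₀ ∈ {u : stdSimplex ℝ A | ∀ a, δ ≤ u a} := fun a => min_le_right _ _
  obtain ⟨u, huK, hu⟩ := hK.exists_isMaxOn ⟨u₀, hu₀K⟩
    ((continuousOn_mirror_objective η b w).mono hsub)
  refine ⟨u, hsub huK, fun u' hu' => ?_⟩
  by_cases hmem : ∀ a, δ ≤ u' a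
  · exact hu hmem
  push Not at hmem
  obtain ⟨a, ha⟩ := hmem
  have h1 : Real.log (u' a) ≤ η * (Φ u₀ - l u₁) := by
    rw [Real.log_le_iff_le_exp (hu' a)]
    exact ha.le.trans (min_le_left _ _)
  have h2 : ∑ a, Real.log (u' a) ≤ Real.log (u' a) := by
    rw [← Finset.add_sum_erase _ _ (Finset.mem_univ a)]
    have : ∑ x ∈ Finset.univ.erase a, Real.log (u' x) ≤ 0 := Finset.sum_nonpos fun x _ =>
      Real.log_nonpos (hu' x).le (stdSimplex.le_one u' x)
    linarith
  have h3 : 1 / η * ∑ a, Real.log (u' a) ≤ Φ u₀ - l u₁ := by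
    rw [one_div, inv_mul_le_iff₀ hη]
    exact h2.trans h1
  have h4 : Φ u' ≤ Φ u₀ := by
    have h5 : l u' ≤ l u₁ := hu₁ (Set.mem_univ u')
    rw [hΦl]
    linarith
  exact h4.trans (hu hu₀K)

/-- Positivity is all that the moment bounds need from the update: it makes the importance weights
exact. -/
theorem mirrorStep_pos {η : ℝ} (hη : 0 < η) (b : A → ℝ) (w : stdSimplex ℝ A) (a : A) :
    0 < mirrorStep η b w a :=
  (Classical.epsilon_spec (exists_mirrorStep hη b w)).1 a

theorem oomdPolicy_pos {η : ℝ} (hη : 0 < η) (N B : ℕ) (x : ℕ → S) (y : ℕ → A) (k : ℕ)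
    (s : S) (a : A) : 0 < M.oomdPolicy η N B x y k s a := by
  cases k with
  | zero =>
    change (0 : ℝ) < (Fintype.card A : ℝ)⁻¹
    positivity
  | succ k => exact mirrorStep_pos hη _ _ a

theorem startTimes_congr (N : ℕ) {x x' : ℕ → S} (s : S) (t₂ : ℕ) (h : ∀ i ≤ t₂, x i = x' i)
    (fuel τ : ℕ) : startTimes N x s t₂ fuel τ = startTimes N x' s t₂ fuel τ := by
  induction fuel generalizing τ with
  | zero => rfl
  | succ fuel ih =>
    simp only [startTimes]
    split_ifs with h1 h2 h3 h3
    · rw [ih]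
    · exact absurd (h τ (by omega) ▸ h2) h3
    · exact absurd ((h τ (by omega)).symm ▸ h3) h2
    · exact ih _
    · rfl

theorem add_le_of_mem_startTimes {N : ℕ} {x : ℕ → S} {s : S} {t₂ fuel τ i : ℕ}
    (h : i ∈ startTimes N x s t₂ fuel τ) : i + N ≤ t₂ := by
  induction fuel generalizing τ with
  | zero => simp [startTimes] at h
  | succ fuel ih =>
    simp only [startTimes] at h
    split_ifs at h with h1 h2
    · rcases List.mem_cons.1 h with rfl | h
      · exact h1
      · exact ih h
    · exact ih h
    · simp at h

theorem windowEstimate_congr (N : ℕ) (π : Policy S A) (s : S) {x x' : ℕ → S} {y y' : ℕ → A}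
    (a : A) (τ : ℕ) (hx : ∀ i ≤ τ + N, x i = x' i) (hy : ∀ i ≤ τ + N, y i = y' i) :
    M.windowEstimate N π s x y a τ = M.windowEstimate N π s x' y' a τ := by
  unfold windowEstimate
  rw [hy τ (by omega), Finset.sum_congr rfl fun t ht => by
    rw [hx t (Finset.mem_Icc.1 ht).2, hy t (Finset.mem_Icc.1 ht).2]]

/-- Every recorded window closes no later than the last time of the episode. -/
theorem episodeEstimate_congr {N B : ℕ} (hB : 0 < B) {x x' : ℕ → S} {y y' : ℕ → A} (k : ℕ)
    (hx : ∀ i < (k + 1) * B, x i = x' i) (hy : ∀ i < (k + 1) * B, y i = y' i) (π : Policy S A)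
    (s : S) (a : A) :
    M.episodeEstimate N B x y k π s a = M.episodeEstimate N B x' y' k π s a := by
  have hkB : 0 < (k + 1) * B := by positivity
  have hmap : ∀ fuel τ, (startTimes N x s ((k + 1) * B - 1) fuel τ).map
      (M.windowEstimate N π s x y a) = (startTimes N x' s ((k + 1) * B - 1) fuel τ).map
      (M.windowEstimate N π s x' y' a) := fun fuel τ => by
    rw [startTimes_congr N s _ (fun i hi => hx i (by omega))]
    refine List.map_congr_left fun i hi => ?_
    have := add_le_of_mem_startTimes hi
    exact M.windowEstimate_congr N π s a i (fun j hj => hx j (by omega)) fun j hj => hy j (by omega)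
  simp only [episodeEstimate, estimateQ]
  rw [hmap, startTimes_congr N s _ (fun i hi => hx i (by omega))]

/-- The policies of an episode depend only on the trajectory before it. -/
theorem oomdPolicies_congr (η : ℝ) {N B : ℕ} (hB : 0 < B) {x x' : ℕ → S} {y y' : ℕ → A} (k : ℕ)
    (hx : ∀ i < k * B, x i = x' i) (hy : ∀ i < k * B, y i = y' i) :
    M.oomdPolicies η N B x y k = M.oomdPolicies η N B x' y' k := by
  induction k with
  | zero => rfl
  | succ k ih =>
    have hle : k * B ≤ (k + 1) * B := Nat.mul_le_mul_right _ (by omega)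
    have hest : M.episodeEstimate N B x y k = M.episodeEstimate N B x' y' k := by
      ext π s a
      exact M.episodeEstimate_congr hB k hx hy π s a
    simp only [oomdPolicies]
    rw [ih (fun i hi => hx i (by omega)) fun i hi => hy i (by omega), hest]

end MDP

/-! ### Expectations over the paths of a policy -/

namespace MDP

variable {S A : Type*} [Fintype S] [DecidableEq S] [Nonempty S]
  [Fintype A] [DecidableEq A] [Nonempty A] (M : MDP S A) (π : Policy S A)

/-- The expectation of `F` over the trajectories that continue `x 0, y 0, …, x n` by `j` steps of
the policy `π` (and agree with `x, y` afterwards). -/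
noncomputable def pathExp : ℕ → ℕ → (ℕ → S) → (ℕ → A) → ((ℕ → S) → (ℕ → A) → ℝ) → ℝ
  | 0, _, x, y, F => F x y
  | j + 1, n, x, y, F => ∑ a, π (x n) a * ∑ s', M.p (x n) a s' *
      pathExp j (n + 1) (Function.update x (n + 1) s') (Function.update y n a) F

/-- The Markov property at time n + i. -/
theorem pathExp_add (i j n : ℕ) (x : ℕ → S) (y : ℕ → A) (F : (ℕ → S) → (ℕ → A) → ℝ) :
    M.pathExp π (i + j) n x y F =
      M.pathExp π i n x y fun x' y' => M.pathExp π j (n + i) x' y' F := by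
  induction i generalizing n x y with
  | zero => simp [pathExp]
  | succ i ih =>
    rw [show i + 1 + j = i + j + 1 by ring]
    simp only [pathExp, ih]
    rw [show n + 1 + i = n + (i + 1) by ring]

theorem pathExp_congr (j n : ℕ) {x : ℕ → S} {y : ℕ → A} {F F' : (ℕ → S) → (ℕ → A) → ℝ}
    (h : ∀ x' y', (∀ i ≤ n, x' i = x i) → (∀ i < n, y' i = y i) → F x' y' = F' x' y') :
    M.pathExp π j n x y F = M.pathExp π j n x y F' := by
  induction j generalizing n x y with
  | zero => exact h x y (fun _ _ => rfl) fun _ _ => rfl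
  | succ j ih =>
    simp only [pathExp]
    refine Finset.sum_congr rfl fun a _ => congrArg _ (Finset.sum_congr rfl fun s' _ =>
      congrArg _ (ih (n + 1) fun x' y' hx hy => h x' y' (fun i hi => ?_) fun i hi => ?_))
    · rw [hx i (by omega), Function.update_of_ne (by omega)]
    · rw [hy i (by omega), Function.update_of_ne (by omega)]

theorem sum_policy (π : Policy S A) (s : S) : ∑ a, π s a = 1 := (π s).2.2

theorem policy_nonneg (π : Policy S A) (s : S) (a : A) : 0 ≤ π s a := (π s).2.1 a

theorem pathExp_const (j n : ℕ) (x : ℕ → S) (y : ℕ → A) (c : ℝ) :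
    M.pathExp π j n x y (fun _ _ => c) = c := by
  induction j generalizing n x y with
  | zero => rfl
  | succ j ih => simp only [pathExp, ih, ← Finset.sum_mul, M.p_sum, one_mul, sum_policy]

theorem pathExp_eq_self (j n : ℕ) {x : ℕ → S} {y : ℕ → A} {F : (ℕ → S) → (ℕ → A) → ℝ}
    (h : ∀ x' y', (∀ i ≤ n, x' i = x i) → (∀ i < n, y' i = y i) → F x' y' = F x y) :
    M.pathExp π j n x y F = F x y := by
  rw [M.pathExp_congr π j n h, pathExp_const]

/-- The endpoint of a path is distributed according to a power of the transition matrix. -/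
theorem pathExp_endpoint (j n : ℕ) (x : ℕ → S) (y : ℕ → A) (h : S → ℝ) :
    M.pathExp π j n x y (fun x' _ => h (x' (n + j))) =
      ∑ u, (M.transition π ^ j) (x n) u * h u := by
  induction j generalizing n x y with
  | zero => simp [pathExp, Matrix.one_apply]
  | succ j ih =>
    have h1 : ∀ s' a, M.pathExp π j (n + 1) (Function.update x (n + 1) s') (Function.update y n a)
        (fun x' _ => h (x' (n + (j + 1)))) = ∑ u, (M.transition π ^ j) s' u * h u := fun s' a => by
      have := ih (n + 1) (Function.update x (n + 1) s') (Function.update y n a)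
      rwa [Function.update_self, show n + 1 + j = n + (j + 1) by ring] at this
    simp only [pathExp, h1, pow_succ', Matrix.mul_apply, transition, Finset.sum_mul, Finset.mul_sum]
    rw [Finset.sum_comm]
    conv_rhs => rw [Finset.sum_comm]
    refine Finset.sum_congr rfl fun s' _ => ?_
    rw [Finset.sum_comm]
    exact Finset.sum_congr rfl fun u _ => Finset.sum_congr rfl fun a _ => by ring

end MDP

/-! ### The law of a run of MDP-OOMD -/

namespace MDP

variable {S A : Type*} [Fintype S] [DecidableEq S] [Nonempty S]
  [Fintype A] [DecidableEq A] [Nonempty A] {M : MDP S A}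
  {Ω : Type*} [MeasurableSpace Ω] {P : Measure Ω} [IsProbabilityMeasure P]
  {X : ℕ → Ω → S} {Y : ℕ → Ω → A} {η : ℝ} {N B T : ℕ}

theorem historyEvent_congr {x x' : ℕ → S} {y y' : ℕ → A} {n m : ℕ}
    (hx : ∀ i < n, x i = x' i) (hy : ∀ i < m, y i = y' i) :
    historyEvent X Y x y n m = historyEvent X Y x' y' n m := by
  ext ω
  refine and_congr (forall₂_congr fun i hi => by rw [hx i hi])
    (forall₂_congr fun i hi => by rw [hy i hi])

theorem IsOOMDRun.measurableSet_historyEvent (h : M.IsOOMDRun η N B T P X Y) (x : ℕ → S)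
    (y : ℕ → A) (n m : ℕ) : MeasurableSet (historyEvent X Y x y n m) := by
  have : historyEvent X Y x y n m =
      (⋂ i ∈ Set.Iio n, X i ⁻¹' {x i}) ∩ ⋂ i ∈ Set.Iio m, Y i ⁻¹' {y i} := by
    ext ω
    simp [historyEvent]
  rw [this]
  exact (MeasurableSet.biInter (Set.to_countable _) fun i _ => h.measurableSet_state i _).inter
    (MeasurableSet.biInter (Set.to_countable _) fun i _ => h.measurableSet_action i _)

theorem historyEvent_eq_iUnion_action (x : ℕ → S) (y : ℕ → A) (n m : ℕ) :
    historyEvent X Y x y n m = ⋃ a, historyEvent X Y x (Function.update y m a) n (m + 1) := by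
  ext ω
  simp only [historyEvent, Set.mem_ofPred_eq, Set.mem_iUnion]
  constructor
  · rintro ⟨h1, h2⟩
    refine ⟨Y m ω, h1, fun i hi => ?_⟩
    rcases Nat.lt_succ_iff_lt_or_eq.1 hi with hi | rfl
    · rw [Function.update_of_ne hi.ne, h2 i hi]
    · rw [Function.update_self]
  · rintro ⟨a, h1, h2⟩
    refine ⟨h1, fun i hi => ?_⟩
    rw [h2 i (by omega), Function.update_of_ne hi.ne]

theorem historyEvent_eq_iUnion_state (x : ℕ → S) (y : ℕ → A) (n m : ℕ) :
    historyEvent X Y x y n m = ⋃ s, historyEvent X Y (Function.update x n s) y (n + 1) m := by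
  ext ω
  simp only [historyEvent, Set.mem_ofPred_eq, Set.mem_iUnion]
  constructor
  · rintro ⟨h1, h2⟩
    refine ⟨X n ω, fun i hi => ?_, h2⟩
    rcases Nat.lt_succ_iff_lt_or_eq.1 hi with hi | rfl
    · rw [Function.update_of_ne hi.ne, h1 i hi]
    · rw [Function.update_self]
  · rintro ⟨a, h1, h2⟩
    refine ⟨fun i hi => ?_, h2⟩
    rw [h1 i (by omega), Function.update_of_ne hi.ne]

theorem setIntegral_iUnion_of_forall {ι : Type*} [Fintype ι] {s : ι → Set Ω} {f : Ω → ℝ}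
    {c : ι → ℝ} (hs : ∀ i, MeasurableSet (s i)) (hd : Pairwise (Function.onFun Disjoint s))
    (h : ∀ i, IntegrableOn f (s i) P ∧ ∫ ω in s i, f ω ∂P = c i) :
    IntegrableOn f (⋃ i, s i) P ∧ ∫ ω in ⋃ i, s i, f ω ∂P = ∑ i, c i := by
  refine ⟨integrableOn_finite_iUnion.2 fun i => (h i).1, ?_⟩
  rw [integral_iUnion_fintype hs hd fun i => (h i).1]
  exact Finset.sum_congr rfl fun i _ => (h i).2

theorem IsOOMDRun.setIntegral_eq_sum_action (h : M.IsOOMDRun η N B T P X Y) {f : Ω → ℝ}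
    {x : ℕ → S} {y : ℕ → A} {n m : ℕ} {c : A → ℝ}
    (hc : ∀ a, IntegrableOn f (historyEvent X Y x (Function.update y m a) n (m + 1)) P ∧
      ∫ ω in historyEvent X Y x (Function.update y m a) n (m + 1), f ω ∂P = c a) :
    IntegrableOn f (historyEvent X Y x y n m) P ∧
      ∫ ω in historyEvent X Y x y n m, f ω ∂P = ∑ a, c a := by
  rw [historyEvent_eq_iUnion_action]
  refine setIntegral_iUnion_of_forall (fun a => h.measurableSet_historyEvent _ _ _ _) ?_ hc
  intro a a' haa'
  refine Set.disjoint_left.2 fun ω h1 h2 => haa' ?_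
  have h3 := (h1.2 m (Nat.lt_succ_self m)).symm.trans (h2.2 m (Nat.lt_succ_self m))
  simpa using h3

theorem IsOOMDRun.setIntegral_eq_sum_state (h : M.IsOOMDRun η N B T P X Y) {f : Ω → ℝ}
    {x : ℕ → S} {y : ℕ → A} {n m : ℕ} {c : S → ℝ}
    (hc : ∀ s, IntegrableOn f (historyEvent X Y (Function.update x n s) y (n + 1) m) P ∧
      ∫ ω in historyEvent X Y (Function.update x n s) y (n + 1) m, f ω ∂P = c s) :
    IntegrableOn f (historyEvent X Y x y n m) P ∧
      ∫ ω in historyEvent X Y x y n m, f ω ∂P = ∑ s, c s := by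
  rw [historyEvent_eq_iUnion_state]
  refine setIntegral_iUnion_of_forall (fun a => h.measurableSet_historyEvent _ _ _ _) ?_ hc
  intro a a' haa'
  refine Set.disjoint_left.2 fun ω h1 h2 => haa' ?_
  have h3 := (h1.1 n (Nat.lt_succ_self n)).symm.trans (h2.1 n (Nat.lt_succ_self n))
  simpa using h3

/-- Over an event fixing the history up to a time in an episode, a function of the trajectory up to
the end of the episode has the integral computed by the path expectation. -/
theorem IsOOMDRun.setIntegral_historyEvent (h : M.IsOOMDRun η N B T P X Y) (hB : 0 < B) {k : ℕ}
    (hk : (k + 1) * B ≤ T) {F : (ℕ → S) → (ℕ → A) → ℝ}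
    (hF : ∀ x x' y y', (∀ i < (k + 1) * B, x i = x' i) → (∀ i < (k + 1) * B, y i = y' i) →
      F x y = F x' y') (π : Policy S A) (j n : ℕ) (hn : k * B ≤ n)
    (hj : n + j + 1 = (k + 1) * B) {x : ℕ → S} {y : ℕ → A}
    (hπ : M.oomdPolicy η N B x y k = π) :
    IntegrableOn (fun ω => F (fun t => X t ω) fun t => Y t ω)
        (historyEvent X Y x y (n + 1) n) P ∧
      ∫ ω in historyEvent X Y x y (n + 1) n, F (fun t => X t ω) (fun t => Y t ω) ∂P =
        P.real (historyEvent X Y x y (n + 1) n) * M.pathExp π (j + 1) n x y F := by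
  have hpol : ∀ (x' : ℕ → S) (y' : ℕ → A), (∀ i < k * B, x i = x' i) →
      (∀ i < k * B, y i = y' i) → M.oomdPolicy η N B x' y' k = π := fun x' y' hx hy => by
    rw [← hπ, oomdPolicy, oomdPolicy, M.oomdPolicies_congr η hB k hx hy]
  have hdiv : n / B = k := Nat.div_eq_of_lt_le hn (by omega)
  have hact : ∀ a, P.real (historyEvent X Y x (Function.update y n a) (n + 1) (n + 1)) =
      P.real (historyEvent X Y x y (n + 1) n) * π (x n) a := fun a => by
    rw [h.action n (by omega) x _, Function.update_self, hdiv,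
      hpol x _ (fun _ _ => rfl) fun i hi => by rw [Function.update_of_ne (by omega)],
      historyEvent_congr (fun _ _ => rfl)
        fun i (hi : i < n) => Function.update_of_ne hi.ne a y]
  have hgoal : P.real (historyEvent X Y x y (n + 1) n) * M.pathExp π (j + 1) n x y F =
      ∑ a, P.real (historyEvent X Y x y (n + 1) n) * π (x n) a * ∑ s', M.p (x n) a s' *
        M.pathExp π j (n + 1) (Function.update x (n + 1) s') (Function.update y n a) F := by
    rw [pathExp, Finset.mul_sum]
    exact Finset.sum_congr rfl fun a _ => by ring
  rw [hgoal]
  -- At the last step of the episode no transition law is available if the run stops there. None is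
  -- needed: `F` ignores the state at time (k + 1)B, and the transition weights in `pathExp` sum to
  -- 1.
  cases j with
  | zero =>
    refine h.setIntegral_eq_sum_action fun a => ?_
    have hconst : ∀ s', M.pathExp π 0 (n + 1) (Function.update x (n + 1) s')
        (Function.update y n a) F = F x (Function.update y n a) := fun s' => by
      refine hF _ _ _ _ (fun i hi => Function.update_of_ne (by omega) _ _) fun _ _ => rfl
    have hEq : Set.EqOn (fun ω => F (fun t => X t ω) fun t => Y t ω)
        (fun _ => F x (Function.update y n a))
        (historyEvent X Y x (Function.update y n a) (n + 1) (n + 1)) := fun ω hω =>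
      hF _ _ _ _ (fun i hi => hω.1 i (by omega)) fun i hi => hω.2 i (by omega)
    have hm := h.measurableSet_historyEvent x (Function.update y n a) (n + 1) (n + 1)
    refine ⟨(integrableOn_congr_fun hEq hm).2 (integrableOn_const (measure_ne_top _ _)), ?_⟩
    simp only [hconst]
    rw [setIntegral_congr_fun hm hEq, setIntegral_const, smul_eq_mul, hact, ← Finset.sum_mul,
      M.p_sum, one_mul]
  | succ j =>
    refine h.setIntegral_eq_sum_action fun a => ?_
    have hstep := h.setIntegral_eq_sum_state (n := n + 1) (m := n + 1) (x := x)
      (y := Function.update y n a) (f := fun ω => F (fun t => X t ω) fun t => Y t ω)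
      (c := fun s' => P.real (historyEvent X Y x y (n + 1) n) * π (x n) a * (M.p (x n) a s' *
        M.pathExp π (j + 1) (n + 1) (Function.update x (n + 1) s') (Function.update y n a) F)) ?_
    · rwa [← Finset.mul_sum] at hstep
    intro s'
    have hstate : P.real (historyEvent X Y (Function.update x (n + 1) s')
        (Function.update y n a) (n + 1 + 1) (n + 1)) =
        P.real (historyEvent X Y x y (n + 1) n) * π (x n) a * M.p (x n) a s' := by
      have h1 := h.state n (by omega) (Function.update x (n + 1) s') (Function.update y n a)
      rw [Function.update_self, Function.update_self, Function.update_of_ne (by omega),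
        historyEvent_congr (X := X) (n := n + 1)
          (fun i (hi : i < n + 1) => Function.update_of_ne hi.ne s' x) fun _ _ => rfl, hact] at h1
      exact h1
    have hpol' : M.oomdPolicy η N B (Function.update x (n + 1) s') (Function.update y n a) k = π :=
      hpol _ _ (fun i hi => (Function.update_of_ne (by omega) _ _).symm)
        fun i hi => (Function.update_of_ne (by omega) _ _).symm
    have := h.setIntegral_historyEvent hB hk hF π j (n + 1) (by omega) (by omega) hpol'
    rwa [hstate, mul_assoc] at this
termination_by j

end MDP

/-! ### Rewards collected along a path -/

namespace MDP

variable {S A : Type*} [Fintype S] [DecidableEq S] [Nonempty S]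
  [Fintype A] [DecidableEq A] [Nonempty A] (M : MDP S A) (π : Policy S A)

/-- The expectation of a function of the final state and the collected reward (which starts at `c`)
after `i` steps of the policy `π` from `u`. -/
noncomputable def rewardExp : ℕ → S → ℝ → (S → ℝ → ℝ) → ℝ
  | 0, u, c, h => h u c
  | i + 1, u, c, h => ∑ a, π u a * ∑ s', M.p u a s' * rewardExp i s' (c + M.r u a) h

/-- The expectation of a function of the state after a window of ESTIMATE-Q that starts in `s` and of
the window estimate for the action `a`. -/
noncomputable def windowExp (N : ℕ) (s : S) (a : A) (h : S → ℝ → ℝ) : ℝ :=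
  ∑ b, π s b * ∑ s', M.p s b s' * M.rewardExp π N s' (M.r s b)
    fun u c => h u (if b = a then c / π s a else 0)

theorem pathExp_reward (h : S → ℝ → ℝ) (i n : ℕ) (x : ℕ → S) (y : ℕ → A) (c : ℝ) :
    M.pathExp π i n x y (fun x' y' => h (x' (n + i))
      (c + ∑ t ∈ Finset.Ico n (n + i), M.r (x' t) (y' t))) = M.rewardExp π i (x n) c h := by
  induction i generalizing n x y c with
  | zero => simp [pathExp, rewardExp]
  | succ i ih =>
    simp only [pathExp, rewardExp]
    refine Finset.sum_congr rfl fun a _ => congrArg _ (Finset.sum_congr rfl fun s' _ =>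
      congrArg _ ?_)
    have := ih (n + 1) (Function.update x (n + 1) s') (Function.update y n a) (c + M.r (x n) a)
    rw [Function.update_self] at this
    rw [← this]
    refine M.pathExp_congr π _ _ fun x' y' hx hy => ?_
    rw [Finset.sum_eq_sum_Ico_succ_bot (by omega), hx n (by omega), hy n (by omega),
      Function.update_self, Function.update_of_ne (by omega), ← add_assoc,
      show n + i + 1 = n + 1 + i by ring, ← add_assoc]

/-- The first action is split off because it decides the indicator; the other N rewards accumulate
through `rewardExp`. -/
theorem pathExp_window (N : ℕ) {s : S} (a : A) (h : S → ℝ → ℝ) (n : ℕ) {x : ℕ → S} (y : ℕ → A)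
    (hx : x n = s) :
    M.pathExp π (N + 1) n x y (fun x' y' => h (x' (n + (N + 1)))
      (M.windowEstimate N π s x' y' a n)) = M.windowExp π N s a h := by
  subst hx
  simp only [pathExp, windowExp]
  refine Finset.sum_congr rfl fun b _ => congrArg _ (Finset.sum_congr rfl fun s' _ =>
    congrArg _ ?_)
  have := M.pathExp_reward π (fun u c => h u (if b = a then c / π (x n) a else 0)) N (n + 1)
    (Function.update x (n + 1) s') (Function.update y n b) (M.r (x n) b)
  rw [Function.update_self] at this
  rw [← this]
  refine M.pathExp_congr π _ _ fun x' y' hx hy => ?_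
  rw [windowEstimate, show Finset.Icc n (n + N) = Finset.Ico n (n + 1 + N) by ext; simp; omega,
    Finset.sum_eq_sum_Ico_succ_bot (by omega),
    hx n (by omega), hy n (by omega),
    Function.update_self, Function.update_of_ne (by omega), show n + (N + 1) = n + 1 + N by ring]

variable {M π}

/-- The restriction on `c'` records that each reward lies in [0, 1]; it supplies the sign and the
size of the window estimate. -/
theorem rewardExp_mono {i : ℕ} {u : S} {c : ℝ} {h h' : S → ℝ → ℝ}
    (hh : ∀ u' c', c ≤ c' → c' ≤ c + i → h u' c' ≤ h' u' c') :
    M.rewardExp π i u c h ≤ M.rewardExp π i u c h' := by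
  induction i generalizing u c with
  | zero => exact hh u c le_rfl (by simp)
  | succ i ih =>
    refine Finset.sum_le_sum fun a _ => mul_le_mul_of_nonneg_left
      (Finset.sum_le_sum fun s' _ => mul_le_mul_of_nonneg_left (ih fun u' c' h1 h2 => ?_)
        (M.p_nonneg u a s')) (policy_nonneg π u a)
    have h3 := M.r_nonneg u a
    have h4 := M.r_le_one u a
    exact hh u' c' (by linarith) (by push_cast; linarith)

variable (M π)

theorem rewardExp_add (i : ℕ) (u : S) (c : ℝ) (h h' : S → ℝ → ℝ) :
    M.rewardExp π i u c (fun u c => h u c + h' u c) =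
      M.rewardExp π i u c h + M.rewardExp π i u c h' := by
  induction i generalizing u c with
  | zero => rfl
  | succ i ih => simp only [rewardExp, ih, mul_add, Finset.sum_add_distrib]

theorem rewardExp_const_mul (i : ℕ) (u : S) (c d : ℝ) (h : S → ℝ → ℝ) :
    M.rewardExp π i u c (fun u c => d * h u c) = d * M.rewardExp π i u c h := by
  induction i generalizing u c with
  | zero => rfl
  | succ i ih =>
    simp only [rewardExp, ih, Finset.mul_sum]
    exact Finset.sum_congr rfl fun a _ => Finset.sum_congr rfl fun s' _ => by ring

theorem rewardExp_const (i : ℕ) (u : S) (c d : ℝ) :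
    M.rewardExp π i u c (fun _ _ => d) = d := by
  induction i generalizing u c with
  | zero => rfl
  | succ i ih => simp only [rewardExp, ih, ← Finset.sum_mul, M.p_sum, one_mul, sum_policy]

theorem transition_mulVec (f : S → ℝ) (u : S) :
    (M.transition π).mulVec f u = ∑ a, π u a * ∑ s', M.p u a s' * f s' := by
  simp only [Matrix.mulVec, dotProduct, transition, Finset.mul_sum, Finset.sum_mul]
  rw [Finset.sum_comm]
  exact Finset.sum_congr rfl fun a _ => Finset.sum_congr rfl fun s' _ => by ring

theorem rewardExp_id (i : ℕ) (u : S) (c : ℝ) :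
    M.rewardExp π i u c (fun _ c => c) =
      c + ∑ j ∈ Finset.range i, ((M.transition π ^ j).mulVec (M.reward π)) u := by
  induction i generalizing u c with
  | zero => simp [rewardExp]
  | succ i ih =>
    have h1 : ∑ j ∈ Finset.range i, ((M.transition π ^ (j + 1)).mulVec (M.reward π)) u =
        ∑ a, π u a * ∑ s', M.p u a s' *
          ∑ j ∈ Finset.range i, ((M.transition π ^ j).mulVec (M.reward π)) s' := by
      rw [← transition_mulVec, ← Finset.sum_fn, Matrix.mulVec_sum, Finset.sum_apply]
      exact Finset.sum_congr rfl fun j _ => by rw [pow_succ', ← Matrix.mulVec_mulVec]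
    rw [Finset.sum_range_succ', pow_zero, Matrix.one_mulVec, h1]
    simp only [rewardExp, ih, mul_add, Finset.sum_add_distrib, ← Finset.sum_mul, M.p_sum,
      one_mul, sum_policy, reward]
    ring

variable {M π}

theorem windowExp_mono {N : ℕ} {s : S} {a : A} {h h' : S → ℝ → ℝ}
    (hh : ∀ u w, 0 ≤ w → h u w ≤ h' u w) :
    M.windowExp π N s a h ≤ M.windowExp π N s a h' := by
  refine Finset.sum_le_sum fun b _ => mul_le_mul_of_nonneg_left
    (Finset.sum_le_sum fun s' _ => mul_le_mul_of_nonneg_left (rewardExp_mono fun u c h1 h2 => ?_)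
      (M.p_nonneg s b s')) (policy_nonneg π s b)
  refine hh u _ ?_
  split_ifs
  · exact div_nonneg ((M.r_nonneg s b).trans h1) (policy_nonneg π s a)
  · exact le_rfl

variable (M π)

theorem windowExp_add (N : ℕ) (s : S) (a : A) (h h' : S → ℝ → ℝ) :
    M.windowExp π N s a (fun u w => h u w + h' u w) =
      M.windowExp π N s a h + M.windowExp π N s a h' := by
  have := fun b s' => M.rewardExp_add π N s' (M.r s b)
    (fun u c => h u (if b = a then c / π s a else 0))
    (fun u c => h' u (if b = a then c / π s a else 0))
  simp only [windowExp, this, mul_add, Finset.sum_add_distrib]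

theorem windowExp_const_mul (N : ℕ) (s : S) (a : A) (d : ℝ) (h : S → ℝ → ℝ) :
    M.windowExp π N s a (fun u w => d * h u w) = d * M.windowExp π N s a h := by
  have := fun b s' => M.rewardExp_const_mul π N s' (M.r s b) d
    (fun u c => h u (if b = a then c / π s a else 0))
  simp only [windowExp, this, Finset.mul_sum]
  exact Finset.sum_congr rfl fun a _ => Finset.sum_congr rfl fun s' _ => by ring

theorem windowExp_sub (N : ℕ) (s : S) (a : A) (h h' : S → ℝ → ℝ) :
    M.windowExp π N s a (fun u w => h u w - h' u w) =
      M.windowExp π N s a h - M.windowExp π N s a h' := by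
  have h1 := M.windowExp_add π N s a h fun u w => -1 * h' u w
  rw [windowExp_const_mul] at h1
  simp only [neg_one_mul, ← sub_eq_add_neg] at h1
  exact h1

theorem windowExp_const (N : ℕ) (s : S) (a : A) (d : ℝ) :
    M.windowExp π N s a (fun _ _ => d) = d := by
  simp only [windowExp, rewardExp_const, ← Finset.sum_mul, M.p_sum, one_mul, sum_policy]

theorem abs_windowExp_sub_le {N : ℕ} {s : S} {a : A} {h h' g : S → ℝ → ℝ}
    (hh : ∀ u w, 0 ≤ w → |h u w - h' u w| ≤ g u w) :
    |M.windowExp π N s a h - M.windowExp π N s a h'| ≤ M.windowExp π N s a g := by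
  rw [← windowExp_sub, abs_le]
  constructor
  · have := windowExp_mono (M := M) (π := π) (N := N) (s := s) (a := a)
      (h := fun u w => -1 * g u w) (h' := fun u w => h u w - h' u w) fun u w hw => by
        linarith [(abs_le.1 (hh u w hw)).1]
    rw [windowExp_const_mul] at this
    linarith
  · exact windowExp_mono fun u w hw => (abs_le.1 (hh u w hw)).2

/-- The mean of the window estimate. -/
noncomputable def windowMean (N : ℕ) (s : S) (a : A) : ℝ :=
  M.windowExp π N s a fun _ w => w

theorem windowMean_nonneg (N : ℕ) (s : S) (a : A) : 0 ≤ M.windowMean π N s a := by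
  rw [← M.windowExp_const π N s a 0]
  exact windowExp_mono fun _ w hw => hw

/-- Only the first action `a` contributes, and its probability cancels the importance weight. -/
theorem windowMean_eq (N : ℕ) {s : S} {a : A} (hπ : 0 < π s a) :
    M.windowMean π N s a = M.r s a + ∑ s', M.p s a s' *
      ∑ j ∈ Finset.range N, ((M.transition π ^ j).mulVec (M.reward π)) s' := by
  have h1 : ∀ b s', M.rewardExp π N s' (M.r s b) (fun _ c => if b = a then c / π s a else 0) =
      if b = a then (M.r s a + ∑ j ∈ Finset.range N,
        ((M.transition π ^ j).mulVec (M.reward π)) s') / π s a else 0 := fun b s' => by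
    split_ifs with hb
    · subst hb
      have := M.rewardExp_const_mul π N s' (M.r s b) (π s b)⁻¹ fun _ c => c
      rw [rewardExp_id] at this
      simp only [div_eq_inv_mul]
      exact this
    · exact M.rewardExp_const π N s' _ 0
  simp only [windowMean, windowExp, h1]
  rw [Finset.sum_eq_single a (fun b _ hb => by simp [hb]) (by simp)]
  simp only [if_true, Finset.mul_sum, mul_div_assoc']
  have : ∀ s', π s a * (M.p s a s' * (M.r s a + ∑ j ∈ Finset.range N,
      ((M.transition π ^ j).mulVec (M.reward π)) s')) / π s a = M.p s a s' * M.r s a +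
      M.p s a s' * ∑ j ∈ Finset.range N, ((M.transition π ^ j).mulVec (M.reward π)) s' := fun s' => by
    field_simp
  simp only [this, Finset.sum_add_distrib, ← Finset.sum_mul, M.p_sum, one_mul, Finset.mul_sum]

/-- The first action is a with probability π(a|s), and the estimate is then at most (N + 1)/π(a|s);
otherwise it is 0. Squaring loses only one power of π(a|s). -/
theorem windowExp_sq_le (N : ℕ) {s : S} {a : A} (hπ : 0 < π s a) :
    M.windowExp π N s a (fun _ w => w ^ 2) ≤ (N + 1) ^ 2 / π s a := by
  have h1 : ∀ b s', M.rewardExp π N s' (M.r s b)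
      (fun _ c => (if b = a then c / π s a else 0) ^ 2) ≤
        if b = a then ((N + 1) / π s a) ^ 2 else 0 := fun b s' => by
    rw [← M.rewardExp_const π N s' (M.r s b) (if b = a then ((N + 1) / π s a) ^ 2 else 0)]
    refine rewardExp_mono fun u c h2 h3 => ?_
    have h4 := M.r_nonneg s b
    have h5 := M.r_le_one s b
    split_ifs
    · exact pow_le_pow_left₀ (div_nonneg (h4.trans h2) hπ.le)
        (div_le_div_of_nonneg_right (by linarith) hπ.le) 2
    · simp
  calc M.windowExp π N s a (fun _ w => w ^ 2)
      ≤ ∑ b, π s b * ∑ s', M.p s b s' * if b = a then ((N + 1) / π s a) ^ 2 else 0 :=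
        Finset.sum_le_sum fun b _ => mul_le_mul_of_nonneg_left (Finset.sum_le_sum fun s' _ =>
          mul_le_mul_of_nonneg_left (h1 b s') (M.p_nonneg s b s')) (policy_nonneg π s b)
    _ = (N + 1) ^ 2 / π s a := by
        simp only [← Finset.sum_mul, M.p_sum, one_mul]
        simp only [mul_ite, mul_zero, Finset.sum_ite_eq', Finset.mem_univ, if_true]
        field_simp

theorem windowExp_sq_sub_windowMean_le (N : ℕ) {s : S} {a : A} (hπ : 0 < π s a) :
    M.windowExp π N s a (fun _ w => (w - M.windowMean π N s a) ^ 2) ≤ (N + 1) ^ 2 / π s a := by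
  set m := M.windowMean π N s a with hm
  have h1 : M.windowExp π N s a (fun _ w => (w - m) ^ 2) =
      M.windowExp π N s a (fun _ w => w ^ 2) - m ^ 2 := by
    have : (fun (_ : S) (w : ℝ) => (w - m) ^ 2) = fun _ w => w ^ 2 + ((-2 * m) * w + m ^ 2) := by
      ext; ring
    rw [this, windowExp_add, windowExp_add, windowExp_const_mul, windowExp_const,
      show M.windowExp π N s a (fun _ w => w) = m from rfl]
    ring
  rw [h1]
  linarith [M.windowExp_sq_le π N hπ, sq_nonneg m]

end MDP

/-! ### The sampling process of ESTIMATE-Q -/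

namespace MDP

variable {S A : Type*} [Fintype S] [DecidableEq S] [Nonempty S]
  [Fintype A] [DecidableEq A] [Nonempty A] (M : MDP S A) (π : Policy S A)

/-- The expectation of a function `G` of the number and the sum of the recorded windows, for the
process that is in state `u` at time `n` after `m` windows with sum `Z`, ends at time `t₂`, and moves
by `K` from the end of a window to the time at which the search is resumed. -/
noncomputable def sampleExp (K : S → S → ℝ) (N : ℕ) (s : S) (a : A) (t₂ : ℕ) (G : ℕ → ℝ → ℝ) :
    ℕ → ℕ → S → ℕ → ℝ → ℝ
  | 0, _, _, m, Z => G m Z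
  | fuel + 1, n, u, m, Z =>
    if n + N ≤ t₂ then
      if u = s then M.windowExp π N s a fun u' w =>
        ∑ u'', K u' u'' * sampleExp K N s a t₂ G fuel (n + 2 * N) u'' (m + 1) (Z + w)
      else ∑ u', M.transition π u u' * sampleExp K N s a t₂ G fuel (n + 1) u' m Z
    else G m Z

/-- The expectation of a function `g` of the number of recorded windows, for the process that
restarts from `μ` after every window. -/
noncomputable def countExp (μ : S → ℝ) (N : ℕ) (s : S) (t₂ : ℕ) (g : ℕ → ℝ) :
    ℕ → ℕ → S → ℕ → ℝ
  | 0, _, _, m => g m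
  | fuel + 1, n, u, m =>
    if n + N ≤ t₂ then
      if u = s then ∑ u', μ u' * countExp μ N s t₂ g fuel (n + 2 * N) u' (m + 1)
      else ∑ u', M.transition π u u' * countExp μ N s t₂ g fuel (n + 1) u' m
    else g m

/-- The Markov property at the end of each window and at each resumption of the search. The
condition on `j` leaves 2N steps for every iteration, so the path never runs out, even past `t₂`. -/
theorem pathExp_startTimes {N : ℕ} (hN : 1 ≤ N) (s : S) (a : A) (t₂ : ℕ) (G : ℕ → ℝ → ℝ)
    (fuel j n : ℕ) (hj : 2 * N * fuel ≤ j) (x : ℕ → S) (y : ℕ → A) (m : ℕ) (Z : ℝ) :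
    M.pathExp π j n x y (fun x' y' => G (m + (startTimes N x' s t₂ fuel n).length)
      (Z + ((startTimes N x' s t₂ fuel n).map (M.windowEstimate N π s x' y' a)).sum)) =
    M.sampleExp π (fun u u' => (M.transition π ^ (N - 1)) u u') N s a t₂ G fuel n (x n) m Z := by
  induction fuel generalizing j n x y m Z with
  | zero => simp [startTimes, sampleExp, pathExp_const]
  | succ fuel ih =>
    rw [mul_add, mul_one] at hj
    by_cases hn : n + N ≤ t₂
    swap
    · simp [startTimes, sampleExp, pathExp_const, hn]
    by_cases hx : x n = s
    · simp only [sampleExp, hn, hx, if_true]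
      obtain ⟨i, rfl⟩ : ∃ i, j = 2 * N + i := ⟨j - 2 * N, by omega⟩
      have h1 := M.pathExp_add π (2 * N) i n x y (fun x' y' =>
        G (m + (startTimes N x' s t₂ (fuel + 1) n).length)
        (Z + ((startTimes N x' s t₂ (fuel + 1) n).map (M.windowEstimate N π s x' y' a)).sum))
      rw [h1]
      set V := M.sampleExp π (fun u u' => (M.transition π ^ (N - 1)) u u') N s a t₂ G fuel (n + 2 * N)
      have h2 : ∀ x' y', (∀ i ≤ n, x' i = x i) → (∀ i < n, y' i = y i) →
          M.pathExp π i (n + 2 * N) x' y' (fun x' y' =>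
            G (m + (startTimes N x' s t₂ (fuel + 1) n).length)
            (Z + ((startTimes N x' s t₂ (fuel + 1) n).map
              (M.windowEstimate N π s x' y' a)).sum)) =
          V (x' (n + 2 * N)) (m + 1) (Z + M.windowEstimate N π s x' y' a n) := by
        intro x' y' hx' _
        refine Eq.trans ?_ (ih i (n + 2 * N) (by omega) x' y' (m + 1) _)
        refine M.pathExp_congr π _ _ fun x'' y'' hx'' hy'' => ?_
        have h3 : x'' n = s := by rw [hx'' n (by omega), hx' n le_rfl, hx]
        rw [M.windowEstimate_congr N π s a n (fun i hi => (hx'' i (by omega)).symm)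
          fun i hi => (hy'' i (by omega)).symm]
        simp only [startTimes, hn, h3, if_true, List.length_cons, List.map_cons, List.sum_cons]
        rw [add_assoc Z, show m + ((startTimes N x'' s t₂ fuel (n + 2 * N)).length + 1) =
          m + 1 + (startTimes N x'' s t₂ fuel (n + 2 * N)).length by ring]
      -- A window uses N + 1 transitions; the remaining N - 1 form the kernel.
      rw [M.pathExp_congr π (2 * N) n h2, show 2 * N = N + 1 + (N - 1) by omega,
        pathExp_add, ← M.pathExp_window π N a _ n y hx]
      refine M.pathExp_congr π _ _ fun x' y' _ _ => ?_
      rw [← M.pathExp_endpoint π (N - 1) (n + (N + 1)) x' y' fun u'' =>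
        V u'' (m + 1) (Z + M.windowEstimate N π s x' y' a n)]
      refine M.pathExp_congr π _ _ fun x'' y'' hx'' hy'' => ?_
      rw [M.windowEstimate_congr N π s a n (fun i hi => hx'' i (by omega))
          fun i hi => hy'' i (by omega), add_assoc n]
    · simp only [sampleExp, hn, hx, if_true, if_false]
      obtain ⟨i, rfl⟩ : ∃ i, j = i + 1 := ⟨j - 1, by omega⟩
      have h1 : ∀ (b : A) (s' : S), M.pathExp π i (n + 1) (Function.update x (n + 1) s')
          (Function.update y n b) (fun x' y' =>
            G (m + (startTimes N x' s t₂ (fuel + 1) n).length)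
            (Z + ((startTimes N x' s t₂ (fuel + 1) n).map
              (M.windowEstimate N π s x' y' a)).sum)) =
          M.sampleExp π (fun u u' => (M.transition π ^ (N - 1)) u u') N s a t₂ G fuel (n + 1) s'
            m Z := by
        intro b s'
        have h2 := ih i (n + 1) (by omega) (Function.update x (n + 1) s') (Function.update y n b) m Z
        rw [Function.update_self] at h2
        rw [← h2]
        refine M.pathExp_congr π _ _ fun x' y' hx' _ => ?_
        have h3 : x' n ≠ s := by
          rw [hx' n (by omega), Function.update_of_ne (by omega)]
          exact hx
        simp only [startTimes, hn, h3, if_true, if_false]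
      simp only [pathExp, h1]
      exact (M.transition_mulVec π _ _).symm

variable {M π}

/-- Each use of the kernel costs at most one factor 1 + ε. Because the error is relative, no upper
bound on `G` is needed; nonnegativity of the reference value is carried in the same induction. -/
theorem abs_sampleExp_sub_le {K K' : S → S → ℝ} {ε : ℝ} (hε : 0 ≤ ε) (hK : ∀ u u', 0 ≤ K u u')
    (hK' : ∀ u u', 0 ≤ K' u u') (hKK' : ∀ u u', |K u u' - K' u u'| ≤ ε * K' u u') {N : ℕ} {s : S}
    {a : A} {t₂ : ℕ} {G : ℕ → ℝ → ℝ} (hG : ∀ m Z, 0 ≤ Z → 0 ≤ G m Z) (fuel n : ℕ) (u : S) (m : ℕ)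
    {Z : ℝ} (hZ : 0 ≤ Z) :
    0 ≤ M.sampleExp π K' N s a t₂ G fuel n u m Z ∧
    |M.sampleExp π K N s a t₂ G fuel n u m Z - M.sampleExp π K' N s a t₂ G fuel n u m Z| ≤
      ((1 + ε) ^ fuel - 1) * M.sampleExp π K' N s a t₂ G fuel n u m Z := by
  induction fuel generalizing n u m Z with
  | zero => simpa [sampleExp] using hG m Z hZ
  | succ fuel ih =>
    have hpow : 1 ≤ (1 + ε) ^ fuel := one_le_pow₀ (by linarith)
    have hpow' : (1 + ε) ^ fuel ≤ (1 + ε) ^ (fuel + 1) := by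
      rw [pow_succ]
      exact le_mul_of_one_le_right (by positivity) (by linarith)
    simp only [sampleExp]
    split_ifs with h1 h2
    · constructor
      · rw [← M.windowExp_const π N s a 0]
        exact windowExp_mono fun u' w hw => Finset.sum_nonneg fun u'' _ =>
          mul_nonneg (hK' u' u'') (ih _ _ _ (add_nonneg hZ hw)).1
      · rw [← windowExp_const_mul]
        refine M.abs_windowExp_sub_le π fun u' w hw => ?_
        rw [← Finset.sum_sub_distrib, Finset.mul_sum]
        refine (Finset.abs_sum_le_sum_abs _ _).trans (Finset.sum_le_sum fun u'' _ => ?_)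
        obtain ⟨hV0, hV⟩ := ih (n + 2 * N) u'' (m + 1) (add_nonneg hZ hw)
        set V := M.sampleExp π K N s a t₂ G fuel (n + 2 * N) u'' (m + 1) (Z + w)
        set V' := M.sampleExp π K' N s a t₂ G fuel (n + 2 * N) u'' (m + 1) (Z + w)
        have h3 : K u' u'' ≤ (1 + ε) * K' u' u'' := by linarith [(abs_le.1 (hKK' u' u'')).2]
        calc |K u' u'' * V - K' u' u'' * V'|
            = |K u' u'' * (V - V') + (K u' u'' - K' u' u'') * V'| := by congr 1; ring
          _ ≤ K u' u'' * |V - V'| + |K u' u'' - K' u' u''| * V' := by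
              refine (abs_add_le _ _).trans_eq ?_
              rw [abs_mul, abs_mul, abs_of_nonneg (hK u' u''), abs_of_nonneg hV0]
          _ ≤ (1 + ε) * K' u' u'' * (((1 + ε) ^ fuel - 1) * V') + ε * K' u' u'' * V' := by
              refine add_le_add (mul_le_mul h3 hV (abs_nonneg _) ?_)
                (mul_le_mul_of_nonneg_right (hKK' u' u'') hV0)
              exact mul_nonneg (by linarith) (hK' u' u'')
          _ = ((1 + ε) ^ (fuel + 1) - 1) * (K' u' u'' * V') := by rw [pow_succ]; ring
    · have hP : ∀ u', 0 ≤ M.transition π u u' := fun u' =>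
        (M.transition_mem_rowStochastic π).1 u u'
      constructor
      · exact Finset.sum_nonneg fun u' _ => mul_nonneg (hP u') (ih _ _ _ hZ).1
      · rw [← Finset.sum_sub_distrib, Finset.mul_sum]
        refine (Finset.abs_sum_le_sum_abs _ _).trans (Finset.sum_le_sum fun u' _ => ?_)
        obtain ⟨hV0, hV⟩ := ih (n + 1) u' m hZ
        rw [← mul_sub, abs_mul, abs_of_nonneg (hP u'), mul_left_comm]
        exact mul_le_mul_of_nonneg_left
          (hV.trans (mul_le_mul_of_nonneg_right (by linarith) hV0)) (hP u')
    · have := hG m Z hZ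
      exact ⟨this, by rw [sub_self, abs_zero]; exact mul_nonneg (by linarith) this⟩

/-! ### The process with independent restarts -/

variable {μ : S → ℝ} {N : ℕ} {s : S} {a : A} {t₂ : ℕ}

theorem countExp_mono (hμ : ∀ u, 0 ≤ μ u) {g g' : ℕ → ℝ} (fuel n : ℕ) (u : S) (m : ℕ)
    (hg : ∀ i, m ≤ i → g i ≤ g' i) :
    M.countExp π μ N s t₂ g fuel n u m ≤ M.countExp π μ N s t₂ g' fuel n u m := by
  induction fuel generalizing n u m with
  | zero => exact hg m le_rfl
  | succ fuel ih =>
    simp only [countExp]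
    split_ifs
    · exact Finset.sum_le_sum fun u' _ => mul_le_mul_of_nonneg_left
        (ih _ _ _ fun i hi => hg i (by omega)) (hμ u')
    · exact Finset.sum_le_sum fun u' _ => mul_le_mul_of_nonneg_left
        (ih _ _ _ hg) ((M.transition_mem_rowStochastic π).1 u u')
    · exact hg m le_rfl

variable (M π) in
theorem countExp_add (g g' : ℕ → ℝ) (fuel n : ℕ) (u : S) (m : ℕ) :
    M.countExp π μ N s t₂ (fun i => g i + g' i) fuel n u m =
      M.countExp π μ N s t₂ g fuel n u m + M.countExp π μ N s t₂ g' fuel n u m := by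
  induction fuel generalizing n u m with
  | zero => rfl
  | succ fuel ih =>
    simp only [countExp, ih, mul_add, Finset.sum_add_distrib]
    split_ifs <;> rfl

variable (M π) in
theorem countExp_const_mul (d : ℝ) (g : ℕ → ℝ) (fuel n : ℕ) (u : S) (m : ℕ) :
    M.countExp π μ N s t₂ (fun i => d * g i) fuel n u m =
      d * M.countExp π μ N s t₂ g fuel n u m := by
  induction fuel generalizing n u m with
  | zero => rfl
  | succ fuel ih =>
    simp only [countExp, ih, mul_left_comm _ d, ← Finset.mul_sum]
    split_ifs <;> rfl

variable (M π) in
theorem countExp_const (hμ : ∑ u, μ u = 1) (d : ℝ) (fuel n : ℕ) (u : S) (m : ℕ) :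
    M.countExp π μ N s t₂ (fun _ => d) fuel n u m = d := by
  induction fuel generalizing n u m with
  | zero => rfl
  | succ fuel ih =>
    simp only [countExp, ih, ← Finset.sum_mul, hμ, one_mul,
      Matrix.sum_row_of_mem_rowStochastic (M.transition_mem_rowStochastic π)]
    split_ifs <;> rfl

theorem sampleExp_mono {K : S → S → ℝ} (hK : ∀ u u', 0 ≤ K u u') {G G' : ℕ → ℝ → ℝ}
    (hG : ∀ i z, G i z ≤ G' i z) (fuel n : ℕ) (u : S) (m : ℕ) (Z : ℝ) :
    M.sampleExp π K N s a t₂ G fuel n u m Z ≤ M.sampleExp π K N s a t₂ G' fuel n u m Z := by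
  induction fuel generalizing n u m Z with
  | zero => exact hG m Z
  | succ fuel ih =>
    simp only [sampleExp]
    split_ifs
    · exact windowExp_mono fun u' w _ => Finset.sum_le_sum fun u'' _ =>
        mul_le_mul_of_nonneg_left (ih _ _ _ _) (hK u' u'')
    · exact Finset.sum_le_sum fun u' _ => mul_le_mul_of_nonneg_left
        (ih _ _ _ _) ((M.transition_mem_rowStochastic π).1 u u')
    · exact hG m Z

/-- With independent restarts, the deviations of the window estimates from their mean are
uncorrelated with every function of the number of windows. -/
theorem sampleExp_sub_mul_add (g g' : ℕ → ℝ) (fuel n : ℕ) (u : S) (m : ℕ) (Z : ℝ) :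
    M.sampleExp π (fun _ => μ) N s a t₂
      (fun i z => (z - i * M.windowMean π N s a) * g i + g' i) fuel n u m Z =
    (Z - m * M.windowMean π N s a) * M.countExp π μ N s t₂ g fuel n u m +
      M.countExp π μ N s t₂ g' fuel n u m := by
  induction fuel generalizing n u m Z with
  | zero => rfl
  | succ fuel ih =>
    simp only [sampleExp, countExp, ih]
    split_ifs
    · set c := ∑ u', μ u' * M.countExp π μ N s t₂ g fuel (n + 2 * N) u' (m + 1)
      set c' := ∑ u', μ u' * M.countExp π μ N s t₂ g' fuel (n + 2 * N) u' (m + 1)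
      set w₀ := M.windowMean π N s a with hw₀
      -- After a restart, `c` and `c'` do not depend on the window, so the integrand is affine in w
      -- and only its mean enters.
      have h1 : (fun (_ : S) (w : ℝ) => ∑ u', μ u' * ((Z + w - (m + 1 : ℕ) * w₀) *
          M.countExp π μ N s t₂ g fuel (n + 2 * N) u' (m + 1) +
          M.countExp π μ N s t₂ g' fuel (n + 2 * N) u' (m + 1))) =
          fun _ w => ((Z - (m + 1 : ℕ) * w₀) * c + c') + c * w := by
        ext _ w
        simp only [mul_add, Finset.sum_add_distrib, mul_left_comm (μ _), ← Finset.mul_sum]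
        ring
      rw [h1, windowExp_add, windowExp_const, windowExp_const_mul,
        show M.windowExp π N s a (fun _ w => w) = w₀ from rfl]
      push_cast
      ring
    · simp only [mul_add, Finset.sum_add_distrib, mul_left_comm (M.transition π u _),
        ← Finset.mul_sum]
    · rfl

/-- With independent restarts, the second moment of the sum of the deviations, weighted by a function
of the number of windows. -/
theorem sampleExp_sq_sub_mul_add_le (hμ : ∀ u, 0 ≤ μ u) {g : ℕ → ℝ} (g' : ℕ → ℝ) (hg : ∀ i, 0 ≤ g i) {v : ℝ}
    (hv : M.windowExp π N s a (fun _ w => (w - M.windowMean π N s a) ^ 2) ≤ v)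
    (fuel n : ℕ) (u : S) (m : ℕ) (Z : ℝ) :
    M.sampleExp π (fun _ => μ) N s a t₂
      (fun i z => (z - i * M.windowMean π N s a) ^ 2 * g i + g' i) fuel n u m Z ≤
    ((Z - m * M.windowMean π N s a) ^ 2 - m * v) * M.countExp π μ N s t₂ g fuel n u m +
      v * M.countExp π μ N s t₂ (fun i => i * g i) fuel n u m +
      M.countExp π μ N s t₂ g' fuel n u m := by
  induction fuel generalizing n u m Z with
  | zero =>
    simp only [sampleExp, countExp]
    exact le_of_eq (by ring)
  | succ fuel ih =>
    simp only [sampleExp, countExp]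
    set w₀ := M.windowMean π N s a with hw₀
    split_ifs
    · set c := ∑ u', μ u' * M.countExp π μ N s t₂ g fuel (n + 2 * N) u' (m + 1) with hc
      set c' := ∑ u', μ u' * M.countExp π μ N s t₂ (fun i => i * g i) fuel (n + 2 * N) u' (m + 1)
        with hc'
      set c'' := ∑ u', μ u' * M.countExp π μ N s t₂ g' fuel (n + 2 * N) u' (m + 1) with hc''
      -- Zero is written `0 * 0` to use linearity, since `μ` is not assumed to have mass 1 here.
      have hc0 : 0 ≤ c := Finset.sum_nonneg fun u' _ => mul_nonneg (hμ u') <| by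
        have := countExp_mono (M := M) (π := π) (N := N) (s := s) (t₂ := t₂) hμ (g := fun _ => 0 * 0)
          fuel (n + 2 * N) u' (m + 1) fun i _ => (zero_mul (0 : ℝ)).trans_le (hg i)
        rwa [countExp_const_mul, zero_mul] at this
      -- Expansion around the mean: the cross term integrates to 0 and the square adds at most v,
      -- which is the change from m v to (m + 1)v.
      have h1 : ∀ (u' : S) (w : ℝ), 0 ≤ w → ∑ u'', μ u'' * M.sampleExp π (fun _ => μ) N s a t₂
          (fun i z => (z - i * w₀) ^ 2 * g i + g' i) fuel (n + 2 * N) u'' (m + 1) (Z + w) ≤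
          ((Z - m * w₀) ^ 2 - (m + 1) * v) * c + v * c' + c'' + (2 * (Z - m * w₀) * c * (w - w₀)
            + c * (w - w₀) ^ 2) := fun u' w _ => by
        refine (Finset.sum_le_sum fun u'' _ => mul_le_mul_of_nonneg_left (ih _ u'' _ (Z + w))
          (hμ u'')).trans_eq ?_
        simp only [mul_add, Finset.sum_add_distrib, mul_left_comm (μ _), ← Finset.mul_sum, ← hc, ← hc',
          ← hc'']
        push_cast
        ring
      refine (windowExp_mono h1).trans ?_
      have h2 : M.windowExp π N s a (fun _ w => w - w₀) = 0 := by
        rw [windowExp_sub, windowExp_const]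
        exact sub_self _
      rw [windowExp_add, windowExp_const, windowExp_add, windowExp_const_mul, h2,
        windowExp_const_mul]
      nlinarith [mul_le_mul_of_nonneg_left hv hc0]
    · refine (Finset.sum_le_sum fun u' _ => mul_le_mul_of_nonneg_left (ih _ u' _ _)
        ((M.transition_mem_rowStochastic π).1 u u')).trans_eq ?_
      simp only [mul_add, Finset.sum_add_distrib, mul_left_comm (M.transition π u _),
        ← Finset.mul_sum]
    · exact le_of_eq (by ring)

/-- As 0⁰ = 1, the function 0ⁱ is the indicator that no window was found; it vanishes after the
first one. -/
theorem countExp_zero_pow_le (hμ : ∀ u, 0 ≤ μ u) (fuel n : ℕ) (u : S) (m : ℕ) :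
    M.countExp π μ N s t₂ (fun i => 0 ^ i) fuel n u (m + 1) ≤ 0 := by
  refine (countExp_mono (g' := fun _ => 0 * 0) hμ fuel n u (m + 1) fun i hi => ?_).trans_eq ?_
  · rw [zero_pow (by omega), zero_mul]
  · rw [countExp_const_mul, zero_mul]

/-- The target is met within i steps with probability at least that of being there at step i, and a
meeting gains a factor z. The time reserve of 3N covers the 2N steps after a hit; for z = 0 nothing
after the hit matters. -/
theorem countExp_pow_le_aux (hμ : ∀ u, 0 ≤ μ u) (hμ1 : ∑ u, μ u = 1) (hN : 1 ≤ N) {z K : ℝ}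
    (hz0 : 0 ≤ z) (hz1 : z ≤ 1) (hK : 0 ≤ K) {d : ℕ}
    (h : ∀ fuel n u m, t₂ < n + fuel → n + N + d ≤ t₂ →
      M.countExp π μ N s t₂ (fun i => z ^ i) fuel n u m ≤ z ^ m * K)
    (i fuel n : ℕ) (u : S) (m : ℕ) (hfuel : t₂ < n + fuel) (hn : n + N + i + d ≤ t₂)
    (hz : z = 0 ∨ n + i + 3 * N + d ≤ t₂) :
    M.countExp π μ N s t₂ (fun i => z ^ i) fuel n u m ≤
      z ^ m * (K * (1 - (1 - z) * (M.transition π ^ i) u s)) := by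
  have hP := M.transition_mem_rowStochastic π
  have hhit : ∀ i fuel n m, t₂ < n + fuel → n + N + i + d ≤ t₂ →
      (z = 0 ∨ n + i + 3 * N + d ≤ t₂) →
      M.countExp π μ N s t₂ (fun i => z ^ i) fuel n s m ≤ z ^ m * (K * z) := by
    intro i fuel n m hfuel hn hz
    obtain ⟨fuel, rfl⟩ : ∃ f, fuel = f + 1 := ⟨fuel - 1, by omega⟩
    simp only [countExp, if_true, show n + N ≤ t₂ by omega]
    calc _ ≤ ∑ u', μ u' * (z ^ m * (K * z)) := Finset.sum_le_sum fun u' _ =>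
            mul_le_mul_of_nonneg_left (?_ : _ ≤ _) (hμ u')
      _ = _ := by rw [← Finset.sum_mul, hμ1, one_mul]
    rcases hz with rfl | hz
    · simpa using countExp_zero_pow_le hμ fuel (n + 2 * N) u' m
    · exact (h fuel (n + 2 * N) u' (m + 1) (by omega) (by omega)).trans_eq (by ring)
  induction i generalizing fuel n u m with
  | zero =>
    by_cases hu : u = s
    · subst hu
      simpa using hhit 0 fuel n m hfuel hn hz
    · simpa [Matrix.one_apply, hu] using h fuel n u m hfuel (by omega)
  | succ i ih =>
    by_cases hu : u = s
    · subst hu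
      refine (hhit (i + 1) fuel n m hfuel hn hz).trans (mul_le_mul_of_nonneg_left
        (mul_le_mul_of_nonneg_left ?_ hK) (pow_nonneg hz0 m))
      have := mul_le_of_le_one_right (sub_nonneg.2 hz1)
        (Matrix.le_one_of_mem_rowStochastic (pow_mem hP (i + 1)) (i := u) (j := u))
      linarith
    · obtain ⟨fuel, rfl⟩ : ∃ f, fuel = f + 1 := ⟨fuel - 1, by omega⟩
      simp only [countExp, if_true, if_false, hu, show n + N ≤ t₂ by omega]
      refine (Finset.sum_le_sum fun u' _ => mul_le_mul_of_nonneg_left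
        (ih fuel (n + 1) u' m (by omega) (by omega) (hz.imp_right fun _ => by omega))
        (hP.1 u u')).trans_eq ?_
      simp only [mul_left_comm (M.transition π u _), ← Finset.mul_sum]
      rw [pow_succ', Matrix.mul_apply]
      simp only [mul_sub, mul_one, Finset.sum_sub_distrib, mul_left_comm (M.transition π u _),
        ← Finset.mul_sum, Matrix.sum_row_of_mem_rowStochastic hP]

/-- The generating function of the number of windows decays geometrically: every stretch of `c`
steps contributes a factor, if the target state has probability at least `q` after `N` steps from
everywhere. -/
theorem countExp_pow_le (hμ : ∀ u, 0 ≤ μ u) (hμ1 : ∑ u, μ u = 1) (hN : 1 ≤ N) {z q : ℝ}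
    (hz0 : 0 ≤ z) (hz1 : z ≤ 1) (hq : ∀ u, q ≤ (M.transition π ^ N) u s) {c : ℕ} (hc : N ≤ c)
    (hcz : z = 0 ∨ 3 * N ≤ c) (hθ : 0 ≤ 1 - (1 - z) * q) (j : ℕ) (fuel n : ℕ) (u : S) (m : ℕ)
    (hfuel : t₂ < n + fuel) (hn : n + N + j * c ≤ t₂) :
    M.countExp π μ N s t₂ (fun i => z ^ i) fuel n u m ≤ z ^ m * (1 - (1 - z) * q) ^ j := by
  induction j generalizing fuel n u m with
  | zero =>
    rw [pow_zero, mul_one]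
    refine (countExp_mono (g' := fun _ => z ^ m) hμ fuel n u m fun i hi => ?_).trans_eq ?_
    · exact pow_le_pow_of_le_one hz0 hz1 hi
    · rw [M.countExp_const π hμ1]
  | succ j ih =>
    rw [add_mul, one_mul] at hn
    refine (countExp_pow_le_aux hμ hμ1 hN hz0 hz1 (pow_nonneg hθ j) (d := j * c)
      (fun fuel n u m h1 h2 => ih fuel n u m h1 h2) N fuel n u m hfuel (by omega)
      (hcz.imp_right fun _ => by omega)).trans ?_
    rw [pow_succ]
    refine mul_le_mul_of_nonneg_left (mul_le_mul_of_nonneg_left ?_ (pow_nonneg hθ j))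
      (pow_nonneg hz0 m)
    have := mul_le_mul_of_nonneg_left (hq u) (sub_nonneg.2 hz1)
    linarith

theorem countExp_zero_pow_le_exp (hμ : ∀ u, 0 ≤ μ u) (hμ1 : ∑ u, μ u = 1) (hN : 1 ≤ N) {q : ℝ}
    (hq : ∀ u, q ≤ (M.transition π ^ N) u s) (j : ℕ) (fuel n : ℕ) (u : S)
    (hfuel : t₂ < n + fuel) (hn : n + N + j * N ≤ t₂) :
    M.countExp π μ N s t₂ (fun i => 0 ^ i) fuel n u 0 ≤ Real.exp (-(j * q)) := by
  have hq1 : q ≤ 1 := (hq s).trans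
    (Matrix.le_one_of_mem_rowStochastic (pow_mem (M.transition_mem_rowStochastic π) N))
  have := countExp_pow_le hμ hμ1 hN le_rfl zero_le_one hq le_rfl (Or.inl rfl) (by linarith) j fuel n
    u 0 hfuel hn
  rw [pow_zero, one_mul, sub_zero, one_mul] at this
  refine this.trans ?_
  rw [show -((j : ℝ) * q) = j * -q by ring, Real.exp_nat_mul]
  exact pow_le_pow_left₀ (by linarith) (Real.one_sub_le_exp_neg q) j

/-- The mean of the inverse number of windows (which is `0` if there is none). -/
theorem countExp_inv_le (hμ : ∀ u, 0 ≤ μ u) (hμ1 : ∑ u, μ u = 1) (hN : 1 ≤ N) {q : ℝ}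
    (hq0 : 0 < q) (hq : ∀ u, q ≤ (M.transition π ^ N) u s) {j : ℕ} (hj : 1 ≤ j) (fuel n : ℕ) (u : S)
    (hfuel : t₂ < n + fuel) (hn : n + N + j * (3 * N) ≤ t₂) :
    M.countExp π μ N s t₂ (fun i => (i : ℝ)⁻¹) fuel n u 0 ≤ 12 / (j * q) := by
  have hq1 : q ≤ 1 := (hq s).trans
    (Matrix.le_one_of_mem_rowStochastic (pow_mem (M.transition_mem_rowStochastic π) N))
  have hj0 : (0 : ℝ) < j := by exact_mod_cast hj
  have hy0 : 0 < j * q := mul_pos hj0 hq0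
  have hinv : ∀ i : ℕ, (i : ℝ)⁻¹ ≤ 1 := fun i => by
    rcases Nat.eq_zero_or_pos i with rfl | hi
    · simp
    · exact inv_le_one_of_one_le₀ (by exact_mod_cast hi)
  -- Here the claimed bound exceeds 1 and is trivial.
  by_cases hy : j * q < 4
  · refine (countExp_mono (g' := fun _ => 1) hμ fuel n u 0 fun i _ => hinv i).trans ?_
    rw [M.countExp_const π hμ1, le_div_iff₀ hy0]
    linarith
  push Not at hy
  set m₀ := ⌊j * q / 4⌋₊ with hm₀
  have hm1 : 1 ≤ m₀ := Nat.le_floor (by push_cast; linarith)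
  have hm1' : (1 : ℝ) ≤ m₀ := by exact_mod_cast hm1
  have hmle : (m₀ : ℝ) ≤ j * q / 4 := Nat.floor_le (by positivity)
  have hmlt : j * q / 4 < m₀ + 1 := Nat.lt_floor_add_one _
  -- Either i ≥ m₀, or the second term is at least 1. With m₀ about jq/4, the factor 2^m₀ ≤
  -- exp(jq/4) is beaten by the generating function, at most exp(-jq/2).
  have hg : ∀ i : ℕ, (i : ℝ)⁻¹ ≤ (m₀ : ℝ)⁻¹ + 2 ^ m₀ * (1 / 2) ^ i := fun i => by
    by_cases hi : m₀ ≤ i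
    · have : (i : ℝ)⁻¹ ≤ (m₀ : ℝ)⁻¹ := inv_anti₀ (by linarith) (by exact_mod_cast hi)
      have h2 : (0 : ℝ) ≤ 2 ^ m₀ * (1 / 2) ^ i := by positivity
      linarith
    · have h2 : (1 : ℝ) ≤ 2 ^ m₀ * (1 / 2) ^ i := by
        rw [one_div, inv_pow, ← div_eq_mul_inv, one_le_div (by positivity)]
        exact pow_le_pow_right₀ (by norm_num) (by omega)
      have h3 : (0 : ℝ) ≤ (m₀ : ℝ)⁻¹ := by positivity
      linarith [hinv i]
  have h1 := countExp_pow_le (M := M) (π := π) hμ hμ1 hN (z := 1 / 2) (by norm_num) (by norm_num) hq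
    (c := 3 * N) (by omega) (Or.inr le_rfl) (by linarith) j fuel n u 0 hfuel hn
  rw [pow_zero, one_mul] at h1
  have h2 : (1 - (1 - 1 / 2) * q) ^ j ≤ Real.exp (-(j * q / 2)) := by
    rw [show -((j : ℝ) * q / 2) = j * -(q / 2) by ring, Real.exp_nat_mul]
    refine pow_le_pow_left₀ (by linarith) ?_ j
    have := Real.one_sub_le_exp_neg (q / 2)
    linarith
  have h3 : (2 : ℝ) ^ m₀ ≤ Real.exp (j * q / 4) := by
    calc (2 : ℝ) ^ m₀ ≤ Real.exp 1 ^ m₀ :=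
          pow_le_pow_left₀ (by norm_num) (by linarith [Real.add_one_le_exp 1]) _
      _ = Real.exp m₀ := by rw [← Real.exp_nat_mul, mul_one]
      _ ≤ _ := Real.exp_le_exp.2 hmle
  have h4 : (2 : ℝ) ^ m₀ * M.countExp π μ N s t₂ (fun i => (1 / 2) ^ i) fuel n u 0 ≤
      4 / (j * q) := by
    calc _ ≤ Real.exp (j * q / 4) * Real.exp (-(j * q / 2)) :=
          mul_le_mul h3 (h1.trans h2) ?_ (Real.exp_pos _).le
      _ = (Real.exp (j * q / 4))⁻¹ := by rw [← Real.exp_add, ← Real.exp_neg]; ring_nf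
      _ ≤ (j * q / 4)⁻¹ := inv_anti₀ (by positivity) (by linarith [Real.add_one_le_exp (j * q / 4)])
      _ = 4 / (j * q) := by rw [inv_div]
    rw [← M.countExp_const π (N := N) (s := s) (t₂ := t₂) hμ1 0 fuel n u 0]
    exact countExp_mono hμ fuel n u 0 fun i _ => by positivity
  calc _ ≤ M.countExp π μ N s t₂ (fun i => (m₀ : ℝ)⁻¹ + 2 ^ m₀ * (1 / 2) ^ i) fuel n u 0 :=
        countExp_mono hμ fuel n u 0 fun i _ => hg i
    _ = (m₀ : ℝ)⁻¹ + 2 ^ m₀ * M.countExp π μ N s t₂ (fun i => (1 / 2) ^ i) fuel n u 0 := by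
        rw [countExp_add, M.countExp_const π hμ1, countExp_const_mul]
    _ ≤ 8 / (j * q) + 4 / (j * q) := by
        refine add_le_add ?_ h4
        rw [inv_eq_one_div, div_le_div_iff₀ (by linarith) hy0]
        linarith
    _ = 12 / (j * q) := by ring

end MDP

/-! ### Consequences of the choice of the parameters -/

/-- Inequalities between the window length `N` and the episode length `B` that are chosen for the
mixing time `t`, the hitting time `h` and the horizon `T` with logarithm `L`. -/
theorem oomd_parameter_aux {t T N B : ℕ} {h : ℝ} (ht : 1 ≤ t) (hh : 1 ≤ h) (hT : 2 ≤ T)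
    (hN : |(N : ℝ) - 4 * t * Real.logb 2 T| < 1)
    (hB : |(B : ℝ) - 16 * t * h * Real.logb 2 T ^ 2| < 1) (hBT : B ≤ T) :
    7 ≤ Real.logb 2 T ∧ (255 : ℝ) < T ∧ (t : ℝ) ≤ T ∧ h ≤ T ∧ 1 ≤ N ∧ (N : ℝ) + 1 ≤ T ∧
      4 * t * Real.logb 2 T - 1 ≤ N ∧ 3 * (h * Real.logb 2 T) * (N : ℝ) + 2 * N + 2 ≤ B := by
  have hT' : (2 : ℝ) ≤ T := by exact_mod_cast hT
  have ht' : (1 : ℝ) ≤ t := by exact_mod_cast ht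
  have hBT' : (B : ℝ) ≤ T := by exact_mod_cast hBT
  have hT0 : (0 : ℝ) < T := by linarith
  set L := Real.logb 2 T with hL
  have hle : ∀ n : ℕ, (2 : ℝ) ^ n ≤ T → (n : ℝ) ≤ L := fun n hn => by
    rw [hL, Real.le_logb_iff_rpow_le one_lt_two hT0, Real.rpow_natCast]
    exact hn
  rw [abs_lt] at hN hB
  have hL1 : 1 ≤ L := by simpa using hle 1 (by simpa using hT')
  have hth : 1 ≤ t * h := one_le_mul_of_one_le_of_one_le ht' hh
  -- One episode fits into the horizon, so L ≥ c forces T > 16c² - 1. Bootstrapping: L ≥ 1 gives T ≥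
  -- 16, hence L ≥ 4, hence T > 255, hence L ≥ 7.
  have hmul : ∀ c : ℝ, c ^ 2 ≤ L ^ 2 → 16 * c ^ 2 - 1 < T := fun c hc => by
    have : c ^ 2 ≤ t * h * L ^ 2 := hc.trans (le_mul_of_one_le_left (sq_nonneg L) hth)
    linarith
  have hL4 : 4 ≤ L := by
    have h1 : (15 : ℝ) < T := by
      have := hmul 1 (pow_le_pow_left₀ (by norm_num) hL1 2)
      linarith
    have h2 : 16 ≤ T := by
      have : 15 < T := by exact_mod_cast h1
      omega
    have h3 : (16 : ℝ) ≤ T := by exact_mod_cast h2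
    simpa using hle 4 (by linarith)
  have hT255 : (255 : ℝ) < T := by
    have := hmul 4 (pow_le_pow_left₀ (by norm_num) hL4 2)
    linarith
  have hL7 : 7 ≤ L := by simpa using hle 7 (by linarith)
  set p := t * L with hp
  set r := h * L with hr
  have htL : 7 ≤ p := hL7.trans (le_mul_of_one_le_left (by linarith) ht')
  have hhL : 7 ≤ r := hL7.trans (le_mul_of_one_le_left (by linarith) hh)
  have hBpr : 16 * (p * r) - 1 < B := by
    have : 16 * (p * r) = 16 * t * h * L ^ 2 := by rw [hp, hr]; ring
    linarith
  have hpr1 : 7 * p ≤ p * r := by nlinarith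
  have hpr2 : 7 * r ≤ p * r := by nlinarith
  have hNp : (N : ℝ) < 4 * p + 1 := by rw [hp]; linarith
  have hNp' : 4 * p - 1 < (N : ℝ) := by rw [hp]; linarith
  have htp : (t : ℝ) ≤ p := le_mul_of_one_le_right (by linarith) hL1
  have hhr : h ≤ r := le_mul_of_one_le_right (by linarith) hL1
  refine ⟨hL7, hT255, by linarith, by linarith, ?_, by linarith, by linarith, ?_⟩
  · have : (0 : ℝ) < N := by linarith
    exact_mod_cast this
  · have := mul_le_mul_of_nonneg_left hNp.le (show 0 ≤ 3 * r + 2 by linarith)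
    nlinarith

/-- The exponent is at least 4 log₂ T - 2 ≥ 3 log₂ T, and 4^(-3 log₂ T) = T⁻⁶. -/
theorem quarter_pow_le_of_logb {t T N : ℕ} (ht : 1 ≤ t) (hT : (0 : ℝ) < T) (hN1 : 1 ≤ N)
    (hL : 7 ≤ Real.logb 2 T) (hN : 4 * t * Real.logb 2 T - 1 ≤ N) :
    (1 / 4 : ℝ) ^ ((N - 1) / t) ≤ 1 / (T : ℝ) ^ 6 := by
  have ht' : (1 : ℝ) ≤ t := by exact_mod_cast ht
  set r := (N - 1) / t with hr
  have hr1 : N - 1 < t * (r + 1) := Nat.lt_mul_div_succ _ (by omega)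
  have hr2 : (N : ℝ) ≤ t * (r + 1) := by
    have : N ≤ t * (r + 1) := by omega
    exact_mod_cast this
  have hr3 : 4 * Real.logb 2 T - 2 ≤ r := by
    have h1 : t * (4 * Real.logb 2 T - 1) ≤ t * (r + 1 : ℝ) := by
      rw [mul_sub]
      linarith
    have := le_of_mul_le_mul_left h1 (by linarith)
    linarith
  have h1 : (1 / 4 : ℝ) ^ r = (2 : ℝ) ^ (-(2 * r : ℝ)) := by
    rw [Real.rpow_neg two_pos.le, Real.rpow_mul two_pos.le, Real.rpow_natCast, one_div, inv_pow]
    norm_num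
  have h2 : 1 / (T : ℝ) ^ 6 = (2 : ℝ) ^ (-(6 * Real.logb 2 T)) := by
    rw [Real.rpow_neg two_pos.le, mul_comm, Real.rpow_mul two_pos.le,
      Real.rpow_logb two_pos (by norm_num) hT, one_div, show (6 : ℝ) = (6 : ℕ) by norm_num,
      Real.rpow_natCast]
  rw [h1, h2]
  exact Real.rpow_le_rpow_of_exponent_le one_le_two (by linarith)

theorem exists_chunks_ge_log {T N B : ℕ} {h : ℝ} (hh : 1 ≤ h) (hT : (1 : ℝ) ≤ T)
    (hL : 7 ≤ Real.logb 2 T) (hB : 3 * (h * Real.logb 2 T) * (N : ℝ) + 2 * N + 2 ≤ B) :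
    ∃ j : ℕ, N + j * N + 1 ≤ B ∧ 4 * h * Real.log T ≤ j := by
  have hlog : Real.log T = Real.logb 2 T * Real.log 2 := by
    rw [Real.logb, div_mul_cancel₀ _ (Real.log_pos one_lt_two).ne']
  have hhL : 0 ≤ h * Real.logb 2 T := mul_nonneg (by linarith) (by linarith)
  refine ⟨⌈4 * h * Real.log T⌉₊, ?_, Nat.le_ceil _⟩
  -- This is 4 log 2 < 3.
  have h1 : 4 * h * Real.log T ≤ 3 * (h * Real.logb 2 T) := by
    have := mul_le_mul_of_nonneg_left Real.log_two_lt_d9.le hhL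
    rw [hlog]
    linarith
  have h2 := Nat.ceil_lt_add_one (show 0 ≤ 4 * h * Real.log T from
    mul_nonneg (by linarith) (Real.log_nonneg hT))
  have h3 : (N : ℝ) + ⌈4 * h * Real.log T⌉₊ * N + 1 ≤ B := by
    have := mul_le_mul_of_nonneg_right (h2.le.trans (add_le_add_left h1 1))
      (Nat.cast_nonneg (α := ℝ) N)
    linarith
  exact_mod_cast h3

theorem exists_chunks_of_le {N B : ℕ} (hN1 : 1 ≤ N) (hB : 23 * N ≤ B) :
    ∃ j : ℕ, 1 ≤ j ∧ N + j * (3 * N) + 1 ≤ B ∧ B ≤ 12 * N * j := by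
  set j := (B - 1 - N) / (3 * N) with hj
  have hj1 : B - 1 - N < 3 * N * (j + 1) := Nat.lt_mul_div_succ _ (by omega)
  have hj2 : j * (3 * N) ≤ B - 1 - N := Nat.div_mul_le_self _ _
  have hj0 : 1 ≤ j := (Nat.one_le_div_iff (by omega)).2 (by omega)
  refine ⟨j, hj0, by omega, ?_⟩
  have h1 : N ≤ N * j := Nat.le_mul_of_pos_right _ hj0
  have h2 : 3 * N * (j + 1) = 3 * (N * j) + 3 * N := by ring
  have h3 : 12 * N * j = 12 * (N * j) := by ring
  omega

/-- Numerical facts about the window length `N` and the episode length `B` that are chosen for the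
mixing time `t`, the hitting time `h` and the horizon `T`. -/
theorem oomd_parameter_bounds {t T N B : ℕ} {h : ℝ} (ht : 1 ≤ t) (hh : 1 ≤ h) (hT : 2 ≤ T)
    (hN : |(N : ℝ) - 4 * t * Real.logb 2 T| < 1)
    (hB : |(B : ℝ) - 16 * t * h * Real.logb 2 T ^ 2| < 1) (hBT : B ≤ T) :
    1 ≤ N ∧ (N : ℝ) + 1 ≤ T ∧ h ≤ T ∧ (t : ℝ) ≤ T ∧
    (1 / 4 : ℝ) ^ ((N - 1) / t) ≤ 1 / (T : ℝ) ^ 6 ∧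
    (∃ j : ℕ, N + j * N + 1 ≤ B ∧ 4 * h * Real.log T ≤ j) ∧
    ∃ j : ℕ, 1 ≤ j ∧ N + j * (3 * N) + 1 ≤ B ∧ B ≤ 12 * N * j := by
  obtain ⟨hL, hT255, htT, hhT, hN1, hNT, hNL, hBN⟩ := oomd_parameter_aux ht hh hT hN hB hBT
  refine ⟨hN1, hNT, hhT, htT, quarter_pow_le_of_logb ht (by linarith) hN1 hL hNL,
    exists_chunks_ge_log hh (by linarith) hL hBN, exists_chunks_of_le hN1 ?_⟩
  have h1 : 7 ≤ h * Real.logb 2 T := hL.trans (le_mul_of_one_le_left (by linarith) hh)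
  have : (23 : ℝ) * N ≤ B := by
    have := mul_le_mul_of_nonneg_right h1 (Nat.cast_nonneg (α := ℝ) N)
    linarith
  exact_mod_cast this

/-! ### The mean and the variance of the estimator -/

namespace MDP

variable {S A : Type*} [Fintype S] [DecidableEq S] [Nonempty S]
  [Fintype A] [DecidableEq A] [Nonempty A] {M : MDP S A} {π : Policy S A}

theorem windowMean_le (N : ℕ) {s : S} {a : A} (hπ : 0 < π s a) :
    M.windowMean π N s a ≤ N + 1 := by
  rw [M.windowMean_eq π N hπ]
  have h1 : ∀ s', ∑ j ∈ Finset.range N, ((M.transition π ^ j).mulVec (M.reward π)) s' ≤ N :=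
    fun s' => by
      refine (Finset.sum_le_card_nsmul _ _ 1 fun j _ => ?_).trans_eq (by simp)
      exact (abs_le.1 (Matrix.abs_mulVec_le_of_mem_rowStochastic
        (pow_mem (M.transition_mem_rowStochastic π) j) (f := M.reward π) (c := 1)
        (fun s => abs_le.2 ⟨by linarith [M.reward_nonneg π s], M.reward_le_one π s⟩) s')).2
  have h2 := Finset.sum_le_sum fun s' (_ : s' ∈ Finset.univ) =>
    mul_le_mul_of_nonneg_left (h1 s') (M.p_nonneg s a s')
  rw [← Finset.sum_mul, M.p_sum, one_mul] at h2
  linarith [M.r_le_one s a]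

/-- The mean of the window estimate is close to its target. -/
theorem IsErgodic.abs_windowMean_sub_beta_le (hM : M.IsErgodic) (N : ℕ) {s : S} {a : A}
    (hπ : 0 < π s a) :
    |M.windowMean π N s a - M.beta N π s a| ≤
      (1 / 4) ^ (N / M.mixingTime) * (2 * M.mixingTime) := by
  -- By the iterated Poisson equation, only the tail survives in the difference.
  have h1 : M.windowMean π N s a - M.beta N π s a =
      -∑ s', M.p s a s' * ((M.transition π ^ N).mulVec (M.relValue π)) s' := by
    rw [M.windowMean_eq π N hπ, beta, qValue, hM.avgReward_eq]
    conv_lhs => enter [2, 1, 2, 2, s']; rw [hM.relValue_eq_sum_add π N s']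
    simp only [Finset.sum_sub_distrib, Finset.sum_const, Finset.card_range, nsmul_eq_mul, mul_add,
      mul_sub, Finset.sum_add_distrib, ← Finset.sum_mul, M.p_sum]
    ring
  rw [h1, abs_neg]
  calc |∑ s', M.p s a s' * ((M.transition π ^ N).mulVec (M.relValue π)) s'|
      ≤ ∑ s', |M.p s a s' * ((M.transition π ^ N).mulVec (M.relValue π)) s'| :=
        Finset.abs_sum_le_sum_abs _ _
    _ ≤ ∑ s', M.p s a s' * ((1 / 4) ^ (N / M.mixingTime) * (2 * M.mixingTime)) :=
        Finset.sum_le_sum fun s' _ => by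
          rw [abs_mul, abs_of_nonneg (M.p_nonneg s a s')]
          exact mul_le_mul_of_nonneg_left
            (hM.abs_pow_mulVec_le π N (hM.relValue_spec π).2 (hM.abs_relValue_le π) s')
            (M.p_nonneg s a s')
    _ = _ := by rw [← Finset.sum_mul, M.p_sum, one_mul]

variable {μ : S → ℝ} {N : ℕ} {s : S} {a : A} {t₂ : ℕ}

/-- Write z/i as (z - iw)/i + w(1 - 0ⁱ); division by zero reproduces the default estimate 0. The
first term has mean zero. -/
theorem sampleExp_div_eq (hμ1 : ∑ u, μ u = 1) (fuel n : ℕ) (u : S) :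
    M.sampleExp π (fun _ => μ) N s a t₂ (fun i z => z / i) fuel n u 0 0 =
      M.windowMean π N s a * (1 - M.countExp π μ N s t₂ (fun i => 0 ^ i) fuel n u 0) := by
  set w := M.windowMean π N s a with hw
  have h1 : (fun (i : ℕ) (z : ℝ) => z / i) =
      fun (i : ℕ) (z : ℝ) => (z - i * w) * (i : ℝ)⁻¹ + (w + -w * 0 ^ i) := by
    ext i z
    rcases Nat.eq_zero_or_pos i with rfl | hi
    · simp
    · have : (i : ℝ) ≠ 0 := by exact_mod_cast hi.ne'
      rw [zero_pow hi.ne']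
      field_simp
      ring
  rw [h1, sampleExp_sub_mul_add (a := a), countExp_add, countExp_const_mul, M.countExp_const π hμ1]
  simp
  ring

/-- For i ≥ 1 use (x + y)² ≤ 2x² + 2y² with x the averaged deviation and y = w - b; for i = 0 the
error is exactly b². The weight 2/i² turns the second moment into the mean of 2/i. -/
theorem sampleExp_sq_le (hμ : ∀ u, 0 ≤ μ u) (hμ1 : ∑ u, μ u = 1) (hπ : 0 < π s a) (b : ℝ)
    (fuel n : ℕ) (u : S) :
    M.sampleExp π (fun _ => μ) N s a t₂ (fun i z => (z / i - b) ^ 2) fuel n u 0 0 ≤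
      2 * ((N + 1) ^ 2 / π s a) * M.countExp π μ N s t₂ (fun i => (i : ℝ)⁻¹) fuel n u 0 +
        2 * (M.windowMean π N s a - b) ^ 2 +
        b ^ 2 * M.countExp π μ N s t₂ (fun i => 0 ^ i) fuel n u 0 := by
  set w := M.windowMean π N s a with hw
  have h1 : ∀ (i : ℕ) (z : ℝ), (z / i - b) ^ 2 ≤
      (z - i * w) ^ 2 * (2 * ((i : ℝ) ^ 2)⁻¹) + (2 * (w - b) ^ 2 + b ^ 2 * 0 ^ i) := by
    intro i z
    rcases Nat.eq_zero_or_pos i with rfl | hi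
    · simp
      positivity
    · have hi' : (i : ℝ) ≠ 0 := by exact_mod_cast hi.ne'
      rw [zero_pow hi.ne']
      have h2 : z / i - b = (z - i * w) * (i : ℝ)⁻¹ + (w - b) := by field_simp; ring
      have h3 : (z - i * w) ^ 2 * (2 * ((i : ℝ) ^ 2)⁻¹) = 2 * ((z - i * w) * (i : ℝ)⁻¹) ^ 2 := by
        rw [mul_pow, inv_pow]; ring
      rw [h2, h3]
      nlinarith [sq_nonneg ((z - i * w) * (i : ℝ)⁻¹ - (w - b))]
  refine (sampleExp_mono (fun _ => hμ) h1 fuel n u 0 0).trans ?_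
  refine (sampleExp_sq_sub_mul_add_le hμ (g := fun i => 2 * ((i : ℝ) ^ 2)⁻¹) _
    (fun i => by positivity)
    (M.windowExp_sq_sub_windowMean_le π N hπ) fuel n u 0 0).trans_eq ?_
  have h2 : (fun i : ℕ => (i : ℝ) * (2 * ((i : ℝ) ^ 2)⁻¹)) = fun i : ℕ => 2 * (i : ℝ)⁻¹ := by
    ext i
    rcases Nat.eq_zero_or_pos i with rfl | hi
    · simp
    · have hi' : (i : ℝ) ≠ 0 := by exact_mod_cast hi.ne'
      field_simp
  rw [h2, countExp_add, M.countExp_const π hμ1,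
    countExp_const_mul M π 2 (fun i => (i : ℝ)⁻¹), countExp_const_mul M π (b ^ 2)]
  simp
  ring

end MDP

/-! ### The conditional law of the estimator. -/

namespace MDP

variable {S A : Type*} [Fintype S] [DecidableEq S] [Nonempty S]
  [Fintype A] [DecidableEq A] [Nonempty A] {M : MDP S A}
  {Ω : Type*} [MeasurableSpace Ω] {P : Measure Ω} [IsProbabilityMeasure P]
  {X : ℕ → Ω → S} {Y : ℕ → Ω → A} {η : ℝ} {N B T : ℕ}

/-- The conditional law of the estimator of an episode is given by the sampling process. -/
theorem IsOOMDRun.integral_betaHat (h : M.IsOOMDRun η N B T P X Y) (hN : 1 ≤ N) (hB : 1 ≤ B) {k : ℕ}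
    (hk : (k + 1) * B ≤ T) {x : ℕ → S} {y : ℕ → A}
    (hH : P (historyEvent X Y x y (k * B + 1) (k * B)) ≠ 0) (s : S) (a : A) (φ : ℝ → ℝ) :
    ∫ ω, φ (M.betaHat η N B (fun t => X t ω) (fun t => Y t ω) k s a)
      ∂ProbabilityTheory.cond P (historyEvent X Y x y (k * B + 1) (k * B)) =
    M.sampleExp (M.oomdPolicy η N B x y k)
      (fun u u' => (M.transition (M.oomdPolicy η N B x y k) ^ (N - 1)) u u') N s a
      ((k + 1) * B - 1) (fun i z => φ (z / i)) B (k * B) (x (k * B)) 0 0 := by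
  set π := M.oomdPolicy η N B x y k with hπ
  set H := historyEvent X Y x y (k * B + 1) (k * B) with hHdef
  have hkB : (k + 1) * B = k * B + B := by ring
  let F : (ℕ → S) → (ℕ → A) → ℝ := fun x' y' => φ (M.episodeEstimate N B x' y' k π s a)
  have hF : ∀ x x' y y', (∀ i < (k + 1) * B, x i = x' i) → (∀ i < (k + 1) * B, y i = y' i) →
      F x y = F x' y' := fun x x' y y' hx hy => by
    simp only [F]
    rw [M.episodeEstimate_congr hB k hx hy]
  have hpP : P.real H ≠ 0 := by
    rw [measureReal_def]
    exact ENNReal.toReal_ne_zero.2 ⟨hH, measure_ne_top _ _⟩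
  have hm : MeasurableSet H := h.measurableSet_historyEvent _ _ _ _
  have h1 : ∫ ω, φ (M.betaHat η N B (fun t => X t ω) (fun t => Y t ω) k s a)
      ∂ProbabilityTheory.cond P H = M.pathExp π B (k * B) x y F := by
    have h2 := (h.setIntegral_historyEvent hB hk hF π (B - 1) (k * B) le_rfl (by omega) rfl).2
    rw [Nat.sub_add_cancel hB] at h2
    have h3 : Set.EqOn (fun ω => φ (M.betaHat η N B (fun t => X t ω) (fun t => Y t ω) k s a))
        (fun ω => F (fun t => X t ω) fun t => Y t ω) H := fun ω hω => by
      have h4 : M.oomdPolicy η N B (fun t => X t ω) (fun t => Y t ω) k = π := by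
        rw [hπ, oomdPolicy, oomdPolicy, M.oomdPolicies_congr η hB k
          (fun i hi => hω.1 i (by omega)) fun i hi => hω.2 i hi]
      simp only [F, betaHat, h4]
    rw [ProbabilityTheory.cond, integral_smul_measure, setIntegral_congr_fun hm h3, h2, smul_eq_mul,
      ENNReal.toReal_inv, ← measureReal_def, inv_mul_cancel_left₀ hpP]
  rw [h1]
  -- The path is prolonged fictitiously with the same policy, which does not affect `F`, to meet the
  -- length condition of `pathExp_startTimes`.
  have h5 : M.pathExp π B (k * B) x y F =
      M.pathExp π (B + 2 * N * B) (k * B) x y F := by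
    rw [pathExp_add]
    refine M.pathExp_congr π _ _ fun x' y' _ _ => ?_
    refine (M.pathExp_eq_self π _ _ fun x'' y'' hx hy => ?_).symm
    exact hF _ _ _ _ (fun i hi => hx i (by omega)) fun i hi => hy i (by omega)
  rw [h5, ← M.pathExp_startTimes π hN s a ((k + 1) * B - 1) (fun i z => φ (z / i)) B
    (B + 2 * N * B) (k * B) (by omega) x y 0 0]
  refine M.pathExp_congr π _ _ fun x' y' _ _ => ?_
  simp only [F, episodeEstimate, estimateQ, zero_add]
  rw [show (k + 1) * B - 1 + 1 - k * B = B by omega]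
  split_ifs with hL
  · simp [hL]
  · rfl

end MDP

/-! ### Numerical form of the bias and variance bounds. -/

theorem one_add_pow_sub_one_le {T : ℝ} {B : ℕ} (hT : 1 ≤ T) (hB : (B : ℝ) ≤ T) :
    (1 + 1 / T ^ 5) ^ B - 1 ≤ 2 / T ^ 4 := by
  have h0 : (0 : ℝ) < T := by linarith
  have h1 : (1 + 1 / T ^ 5) ^ B ≤ Real.exp (1 / T ^ 4) := by
    calc (1 + 1 / T ^ 5) ^ B ≤ Real.exp (1 / T ^ 5) ^ B :=
          pow_le_pow_left₀ (by positivity) (by linarith [Real.add_one_le_exp (1 / T ^ 5)]) _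
      _ = Real.exp (B * (1 / T ^ 5)) := (Real.exp_nat_mul _ _).symm
      _ ≤ Real.exp (T * (1 / T ^ 5)) :=
          Real.exp_le_exp.2 (mul_le_mul_of_nonneg_right hB (by positivity))
      _ = Real.exp (1 / T ^ 4) := by congr 1; field_simp
  have h2 : 1 / T ^ 4 ≤ 1 := by
    rw [div_le_one (by positivity)]
    exact one_le_pow₀ hT
  have h3 := Real.abs_exp_sub_one_le (x := 1 / T ^ 4) (by rwa [abs_of_nonneg (by positivity)])
  rw [abs_of_nonneg (show 0 ≤ 1 / T ^ 4 by positivity)] at h3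
  have h4 := (abs_le.1 h3).2
  have h5 : 2 / T ^ 4 = 2 * (1 / T ^ 4) := by ring
  linarith

/-- Three errors: 2/T from the restarts, 1/T from finding no window, 2/T from the mean of a single
window. -/
theorem bias_bound {T N w b t p₀ V V' : ℝ} (hT : 1 ≤ T) (hNT : N + 1 ≤ T) (hw0 : 0 ≤ w)
    (hw : w ≤ N + 1) (ht : t ≤ T) (hp0 : 0 ≤ p₀) (hp : p₀ ≤ 1 / T ^ 2)
    (hwb : |w - b| ≤ 1 / T ^ 6 * (2 * t)) (hV' : V' = w * (1 - p₀))
    (hV : |V - V'| ≤ 2 / T ^ 4 * V') : |V - b| ≤ 5 / T := by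
  have h0 : (0 : ℝ) < T := by linarith
  have hle : ∀ n : ℕ, 1 / T ^ (n + 1) ≤ 1 / T := fun n =>
    one_div_le_one_div_of_le h0 (le_self_pow₀ hT (by omega))
  have h1 : |V' - w| ≤ 1 / T := by
    rw [hV', show w * (1 - p₀) - w = -(w * p₀) by ring, abs_neg, abs_of_nonneg (mul_nonneg hw0 hp0)]
    calc w * p₀ ≤ T * (1 / T ^ 2) := mul_le_mul (hw.trans hNT) hp hp0 h0.le
      _ = 1 / T := by field_simp
  have h2 : |V - V'| ≤ 2 / T := by
    refine hV.trans ?_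
    have : V' ≤ T := by
      rw [hV']
      nlinarith [mul_nonneg hw0 hp0]
    calc 2 / T ^ 4 * V' ≤ 2 / T ^ 4 * T := mul_le_mul_of_nonneg_left this (by positivity)
      _ = 2 * (1 / T ^ (2 + 1)) := by field_simp
      _ ≤ 2 * (1 / T) := by linarith [hle 2]
      _ = 2 / T := by ring
  have h3 : |w - b| ≤ 2 / T := by
    calc |w - b| ≤ 1 / T ^ 6 * (2 * T) :=
          hwb.trans (mul_le_mul_of_nonneg_left (by linarith) (by positivity))
      _ = 2 * (1 / T ^ (4 + 1)) := by field_simp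
      _ ≤ 2 * (1 / T) := by linarith [hle 4]
      _ = 2 / T := by ring
  have h4 : |V - b| ≤ |V - V'| + |V' - w| + |w - b| := by
    rw [show V - b = (V - V') + (V' - w) + (w - b) by ring]
    exact abs_add_three _ _ _
  calc |V - b| ≤ 2 / T + 1 / T + 2 / T := by linarith
    _ = 5 / T := by ring

/-- The constant is 2304 + 2 + 9, one summand per term. The last two terms are absorbed since N²/T²
≤ N³/(Bpm). -/
theorem variance_bound {T N B j w b t p₀ e p m : ℝ} (hT : 2 ≤ T) (hN : 1 ≤ N)
    (hB : 1 ≤ B) (hBT : B ≤ T) (hj : 0 < j) (hBj : B ≤ 12 * N * j) (hw0 : 0 ≤ w) (hw : w ≤ N + 1)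
    (ht : t ≤ T) (hp0 : 0 ≤ p₀) (hp₀ : p₀ ≤ 1 / T ^ 2) (hwb : |w - b| ≤ 1 / T ^ 6 * (2 * t))
    (he : e ≤ 12 / (j * (m / 2))) (hp : 0 < p) (hp1 : p ≤ 1) (hm : 0 < m) (hm1 : m ≤ 1) :
    2 * ((N + 1) ^ 2 / p) * e + 2 * (w - b) ^ 2 + b ^ 2 * p₀ ≤ 2315 * (N ^ 3 / (B * p * m)) := by
  have h0 : (0 : ℝ) < T := by linarith
  have hB0 : 0 < B := by linarith
  have hN0 : 0 < N := by linarith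
  set U := N ^ 3 / (B * p * m) with hU
  have hU1 : N ^ 2 / T ^ 2 ≤ U := by
    rw [hU, div_le_div_iff₀ (by positivity) (by positivity)]
    have h1 : B * p * m ≤ T ^ 2 := by
      have h2 : p * m ≤ 1 := mul_le_one₀ hp1 hm.le hm1
      have h3 : B * (p * m) ≤ B * 1 := mul_le_mul_of_nonneg_left h2 hB0.le
      nlinarith
    calc N ^ 2 * (B * p * m) ≤ N ^ 2 * T ^ 2 := mul_le_mul_of_nonneg_left h1 (by positivity)
      _ ≤ N ^ 3 * T ^ 2 := mul_le_mul_of_nonneg_right (pow_le_pow_right₀ hN (by norm_num))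
          (by positivity)
  have hwb' : |w - b| ≤ 1 / T := by
    refine hwb.trans ((mul_le_mul_of_nonneg_left (show 2 * t ≤ T ^ 2 by nlinarith)
      (by positivity)).trans ?_)
    calc 1 / T ^ 6 * T ^ 2 = 1 / T ^ 4 := by field_simp
      _ ≤ 1 / T := one_div_le_one_div_of_le h0 (le_self_pow₀ (by linarith) (by norm_num))
  have h1 : (w - b) ^ 2 ≤ U := by
    calc (w - b) ^ 2 = |w - b| ^ 2 := (sq_abs _).symm
      _ ≤ (1 / T) ^ 2 := pow_le_pow_left₀ (abs_nonneg _) hwb' 2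
      _ = 1 / T ^ 2 := by ring
      _ ≤ N ^ 2 / T ^ 2 := div_le_div_of_nonneg_right (one_le_pow₀ hN) (by positivity)
      _ ≤ U := hU1
  have h2 : b ^ 2 * p₀ ≤ 9 * U := by
    have h3 : |b| ≤ 3 * N := by
      have h4 : 1 / T ≤ 1 := by rw [div_le_one h0]; linarith
      have h5 := abs_le.1 hwb'
      rw [abs_le]
      constructor <;> linarith [h5.1, h5.2]
    calc b ^ 2 * p₀ ≤ (3 * N) ^ 2 * (1 / T ^ 2) := by
          refine mul_le_mul ?_ hp₀ hp0 (by positivity)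
          rw [← sq_abs]
          exact pow_le_pow_left₀ (abs_nonneg _) h3 2
      _ = 9 * (N ^ 2 / T ^ 2) := by ring
      _ ≤ 9 * U := by linarith
  have h3 : 2 * ((N + 1) ^ 2 / p) * e ≤ 2304 * U := by
    have h4 : e ≤ 288 * N / (B * m) := by
      refine he.trans ?_
      rw [div_le_div_iff₀ (by positivity) (by positivity)]
      nlinarith [mul_le_mul_of_nonneg_right hBj hm.le]
    have h5 : (N + 1) ^ 2 ≤ 4 * N ^ 2 := by nlinarith
    calc 2 * ((N + 1) ^ 2 / p) * e ≤ 2 * ((N + 1) ^ 2 / p) * (288 * N / (B * m)) :=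
          mul_le_mul_of_nonneg_left h4 (by positivity)
      _ ≤ 2 * (4 * N ^ 2 / p) * (288 * N / (B * m)) := by gcongr
      _ = 2304 * U := by rw [hU]; field_simp; norm_num
  linarith

/-! ### Assembly of the bounds. -/

namespace MDP

variable {S A : Type*} [Fintype S] [DecidableEq S] [Nonempty S]
  [Fintype A] [DecidableEq A] [Nonempty A] {M : MDP S A}

theorem IsErgodic.abs_pow_apply_sub_le_mul_stationary (hM : M.IsErgodic) (π : Policy S A)
    {T : ℝ} (hT : 0 < T) (hh : M.hittingTime ≤ T) {n : ℕ}
    (hn : (1 / 4 : ℝ) ^ (n / M.mixingTime) ≤ 1 / T ^ 6) (u u' : S) :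
    |(M.transition π ^ n) u u' - M.stationary π u'| ≤ 1 / T ^ 5 * M.stationary π u' := by
  refine ((hM.abs_pow_apply_sub_stationary_le π n u u').trans hn).trans ?_
  have h1 : 1 ≤ M.stationary π u' * T := (hM.one_le_stationary_mul_hittingTime π u').trans
    (mul_le_mul_of_nonneg_left hh (hM.stationary_pos π u').le)
  rw [div_mul_eq_mul_div, one_mul, div_le_div_iff₀ (by positivity) (by positivity), one_mul]
  calc T ^ 5 ≤ (M.stationary π u' * T) * T ^ 5 := le_mul_of_one_le_left (by positivity) h1
    _ = M.stationary π u' * T ^ 6 := by ring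

theorem IsErgodic.one_le_hittingTime (hM : M.IsErgodic) : 1 ≤ M.hittingTime := by
  obtain ⟨s⟩ := ‹Nonempty S›
  let π : Policy S A := fun _ => stdSimplex.barycenter
  have h0 := hM.stationary_pos π s
  refine le_trans ?_ (hM.one_div_stationary_le π s)
  rw [le_div_iff₀ h0, one_mul]
  exact stdSimplex.le_one _ s

/-- Bias and mean square error of the sampling process of ESTIMATE-Q. -/
theorem IsErgodic.sampleExp_bounds (hM : M.IsErgodic) (π : Policy S A) {s : S} {a : A}
    (hπ : 0 < π s a) {T N B t₂ n : ℕ} (hT : 2 ≤ T) (hN : 1 ≤ N) (hB : 1 ≤ B) (hBT : B ≤ T)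
    (hNT : (N : ℝ) + 1 ≤ T) (hhT : M.hittingTime ≤ T) (htT : (M.mixingTime : ℝ) ≤ T)
    (hmix : (1 / 4 : ℝ) ^ ((N - 1) / M.mixingTime) ≤ 1 / (T : ℝ) ^ 6)
    (hj₀ : ∃ j : ℕ, N + j * N + 1 ≤ B ∧ 4 * M.hittingTime * Real.log T ≤ j)
    (hj₁ : ∃ j : ℕ, 1 ≤ j ∧ N + j * (3 * N) + 1 ≤ B ∧ B ≤ 12 * N * j)
    (ht₂ : t₂ + 1 = n + B) (u : S) :
    |M.sampleExp π (fun u u' => (M.transition π ^ (N - 1)) u u') N s a t₂ (fun i z => z / i) B n u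
        0 0 - M.beta N π s a| ≤ 14000 / T ∧
    M.sampleExp π (fun u u' => (M.transition π ^ (N - 1)) u u') N s a t₂
        (fun i z => (z / i - M.beta N π s a) ^ 2) B n u 0 0 ≤
      14000 * ((N : ℝ) ^ 3 * Real.log T / (B * π s a * M.stationary π s)) := by
  set μ : S → ℝ := fun s => M.stationary π s with hμdef
  have hμ : ∀ u, 0 ≤ μ u := fun u => (hM.stationary_pos π u).le
  have hμ1 : ∑ u, μ u = 1 := (M.stationary π).2.2
  have hT2 : (2 : ℝ) ≤ T := by exact_mod_cast hT
  have hT0 : (0 : ℝ) < T := by linarith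
  have hT1 : (1 : ℝ) ≤ T := by linarith
  have hN' : (1 : ℝ) ≤ N := by exact_mod_cast hN
  have hB' : (1 : ℝ) ≤ B := by exact_mod_cast hB
  have hBT' : (B : ℝ) ≤ T := by exact_mod_cast hBT
  have hms : 0 < M.stationary π s := hM.stationary_pos π s
  have hms1 : M.stationary π s ≤ 1 := stdSimplex.le_one _ s
  have hmixN : (1 / 4 : ℝ) ^ (N / M.mixingTime) ≤ 1 / (T : ℝ) ^ 6 :=
    (pow_le_pow_of_le_one (by norm_num) (by norm_num)
      (Nat.div_le_div_right (Nat.sub_le N 1))).trans hmix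
  have hP := M.transition_mem_rowStochastic π
  set K : S → S → ℝ := fun u u' => (M.transition π ^ (N - 1)) u u' with hKdef
  have hK : ∀ u u', 0 ≤ K u u' := fun u u' => (pow_mem hP (N - 1)).1 u u'
  have hq : ∀ u, M.stationary π s / 2 ≤ (M.transition π ^ N) u s := fun u => by
    have h1 := (abs_le.1 (hM.abs_pow_apply_sub_le_mul_stationary π hT0 hhT hmixN u s)).1
    have h2 : 1 / (T : ℝ) ^ 5 ≤ 1 / 2 := one_div_le_one_div_of_le two_pos
      (hT2.trans (le_self_pow₀ hT1 (by norm_num)))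
    have h3 := mul_le_mul_of_nonneg_right h2 hms.le
    linarith
  set w := M.windowMean π N s a with hw
  set p₀ := M.countExp π μ N s t₂ (fun i => 0 ^ i) B n u 0 with hp₀def
  have hp0 : 0 ≤ p₀ := by
    rw [← M.countExp_const π (N := N) (s := s) (t₂ := t₂) hμ1 0 B n u 0]
    exact countExp_mono hμ B n u 0 fun i _ => by positivity
  have hp₀ : p₀ ≤ 1 / (T : ℝ) ^ 2 := by
    obtain ⟨j, hj, hjlog⟩ := hj₀
    refine (countExp_zero_pow_le_exp hμ hμ1 hN hq j B n u (by omega) (by omega)).trans ?_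
    -- As j ≥ 4 t_hit log T and μ(s) t_hit ≥ 1.
    have h1 : 2 * Real.log T ≤ j * (M.stationary π s / 2) := by
      have h2 := mul_le_mul_of_nonneg_right hjlog (half_pos hms).le
      have h3 := mul_le_mul_of_nonneg_right (hM.one_le_stationary_mul_hittingTime π s)
        (Real.log_nonneg hT1)
      nlinarith
    calc Real.exp (-(j * (M.stationary π s / 2))) ≤ Real.exp (-(2 * Real.log T)) :=
          Real.exp_le_exp.2 (by linarith)
      _ = 1 / (T : ℝ) ^ 2 := by
          rw [Real.exp_neg, show 2 * Real.log T = (2 : ℕ) * Real.log T by norm_num,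
            Real.exp_nat_mul, Real.exp_log hT0, one_div]
  have hw0 : 0 ≤ w := M.windowMean_nonneg π N s a
  have hw1 : w ≤ N + 1 := windowMean_le N hπ
  have hwb : |w - M.beta N π s a| ≤ 1 / (T : ℝ) ^ 6 * (2 * M.mixingTime) :=
    (hM.abs_windowMean_sub_beta_le N hπ).trans
      (mul_le_mul_of_nonneg_right hmixN (by positivity))
  have hcmp : ∀ G : ℕ → ℝ → ℝ, (∀ m Z, 0 ≤ Z → 0 ≤ G m Z) →
      |M.sampleExp π K N s a t₂ G B n u 0 0 - M.sampleExp π (fun _ => μ) N s a t₂ G B n u 0 0| ≤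
        2 / (T : ℝ) ^ 4 * M.sampleExp π (fun _ => μ) N s a t₂ G B n u 0 0 := fun G hG => by
    obtain ⟨h1, h2⟩ := abs_sampleExp_sub_le (M := M) (π := π) (N := N) (s := s) (a := a) (t₂ := t₂)
      (ε := 1 / (T : ℝ) ^ 5) (by positivity) hK (fun _ => hμ)
      (fun u u' => hM.abs_pow_apply_sub_le_mul_stationary π hT0 hhT hmix u u') hG B n u 0 le_rfl
    exact h2.trans (mul_le_mul_of_nonneg_right (one_add_pow_sub_one_le hT1 hBT') h1)
  constructor
  · have h1 := bias_bound hT1 hNT hw0 hw1 htT hp0 hp₀ hwb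
      (sampleExp_div_eq (a := a) (N := N) (s := s) (t₂ := t₂) hμ1 B n u)
      (hcmp _ fun m Z hZ => div_nonneg hZ (Nat.cast_nonneg m))
    exact h1.trans (div_le_div_of_nonneg_right (by norm_num) hT0.le)
  · obtain ⟨j, hj, hjB, hBj⟩ := hj₁
    have he := countExp_inv_le (t₂ := t₂) hμ hμ1 hN (half_pos hms) hq hj B n u (by omega) (by omega)
    have hvar := variance_bound hT2 hN' hB' hBT' (by exact_mod_cast hj) (by exact_mod_cast hBj)
      hw0 hw1 htT hp0 hp₀ hwb he hπ (stdSimplex.le_one (π s) a) hms hms1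
    have hV' := (sampleExp_sq_le (N := N) (t₂ := t₂) hμ hμ1 hπ (M.beta N π s a) B n u).trans hvar
    have hV := (abs_le.1 (hcmp (fun i z => (z / i - M.beta N π s a) ^ 2)
      fun m Z _ => sq_nonneg _)).2
    set V' := M.sampleExp π (fun _ => μ) N s a t₂ (fun i z => (z / i - M.beta N π s a) ^ 2) B n u 0 0
    set U := (N : ℝ) ^ 3 / (B * π s a * M.stationary π s) with hU
    have hU0 : 0 ≤ U := by positivity
    have h1 : 2 / (T : ℝ) ^ 4 * V' ≤ 2 * (2315 * U) := by
      have h2 : 2 / (T : ℝ) ^ 4 ≤ 2 := div_le_self zero_le_two (one_le_pow₀ hT1)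
      calc 2 / (T : ℝ) ^ 4 * V' ≤ 2 / (T : ℝ) ^ 4 * (2315 * U) :=
            mul_le_mul_of_nonneg_left hV' (by positivity)
        _ ≤ 2 * (2315 * U) := mul_le_mul_of_nonneg_right h2 (by positivity)
    -- The argument yields 3 · 2315 U without a logarithm; log T ≥ 1/2 converts this to 13890 U log
    -- T.
    have hlog : 1 / 2 ≤ Real.log T := by
      have := Real.log_le_log two_pos hT2
      linarith [Real.log_two_gt_d9]
    have h3 : (N : ℝ) ^ 3 * Real.log T / (B * π s a * M.stationary π s) = U * Real.log T := by
      rw [hU]; ring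
    rw [h3]
    have h4 := mul_le_mul_of_nonneg_left hlog hU0
    linarith

end MDP

theorem mainTheorem5 :
    ∃ C : ℝ, 0 < C ∧
      ∀ (S A : Type*) [Fintype S] [DecidableEq S] [Nonempty S]
        [Fintype A] [DecidableEq A] [Nonempty A]
        (M : MDP S A) (_ : M.IsErgodic) (η : ℝ) (_ : 0 < η) (T N B : ℕ) (_ : 2 ≤ T)
        (_ : |(N : ℝ) - 4 * M.mixingTime * Real.logb 2 T| < 1)
        (_ : |(B : ℝ) - 16 * M.mixingTime * M.hittingTime * Real.logb 2 T ^ 2| < 1)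
        (Ω : Type*) [MeasurableSpace Ω] (P : Measure Ω) [IsProbabilityMeasure P]
        (X : ℕ → Ω → S) (Y : ℕ → Ω → A) (_ : M.IsOOMDRun η N B T P X Y)
        (k : ℕ) (_ : (k + 1) * B ≤ T) (x : ℕ → S) (y : ℕ → A)
        (_ : P (MDP.historyEvent X Y x y (k * B + 1) (k * B)) ≠ 0) (s : S) (a : A),
        let π := M.oomdPolicy η N B x y k
        let Q := ProbabilityTheory.cond P (MDP.historyEvent X Y x y (k * B + 1) (k * B))
        let est : Ω → ℝ := fun ω => M.betaHat η N B (fun t => X t ω) (fun t => Y t ω) k s a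
        |(∫ ω, est ω ∂Q) - M.beta N π s a| ≤ C / T ∧
        ∫ ω, (est ω - M.beta N π s a) ^ 2 ∂Q ≤
          C * ((N : ℝ) ^ 3 * Real.log T / (B * π s a * M.stationary π s)) := by
  refine ⟨14000, by norm_num, ?_⟩
  intro S A _ _ _ _ _ _ M hM η hη T N B hT hN hB Ω _ P _ X Y hrun k hk x y hH s a
  have hBT : B ≤ T := le_trans (Nat.le_mul_of_pos_left B (Nat.succ_pos k)) hk
  obtain ⟨hN1, hNT, hhT, htT, hmix, hj₀, hj₁⟩ := oomd_parameter_bounds hM.one_le_mixingTime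
    hM.one_le_hittingTime hT hN hB hBT
  have hB1 : 1 ≤ B := by
    obtain ⟨j, -, hj, -⟩ := hj₁
    omega
  have hkB : (k + 1) * B = k * B + B := by ring
  have hmain := hM.sampleExp_bounds (M.oomdPolicy η N B x y k) (M.oomdPolicy_pos hη N B x y k s a)
    hT hN1 hB1 hBT hNT hhT htT hmix hj₀ hj₁ (t₂ := (k + 1) * B - 1) (n := k * B) (by omega)
    (x (k * B))
  rw [← hrun.integral_betaHat hN1 hB1 hk hH s a fun b => b,
    ← hrun.integral_betaHat hN1 hB1 hk hH s a fun b => (b - M.beta N _ s a) ^ 2] at hmain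
  exact hmain
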